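/- A partially oriented graph $P=(V,E\cup A)$ consists of a finite simple graph $(V,E)$ and an oriented graph $(V,A)$ (a digraph without loops and with at most one arc joining any two vertices) on the same vertex set, such that no two vertices are joined both by an edge and by an arc. To complete $P$ means to replace each edge in $E$ by an arc in one of its two possible directions, so that an oriented graph is obtained. A local tournament is an oriented graph in which, for every vertex $v$, the in-neighbourhood $N^-(v)$ and the out-neighbourhood $N^+(v)$ each induce a tournament; it is acyclic if it contains no directed cycle. The orientation completion problem for the class of acyclic local tournaments is the following decision problem: given a partially oriented graph $P$, can $P$ be completed to an acyclic local tournament? **Theorem.** The orientation completion problem for the class of acyclic local tournaments is solvable in polynomial time: there are an algorithm and a polynomial $f$ such that, for every partially oriented graph $P$ on the vertices $0,\dots,n-1$, given as the number $n$ followed by its $n\times n$ adjacency matrix row by row (with entry $1$ at $(u,v)$ if $uv\in E$, $2$ if $(u,v)\in A$, $3$ if $(v,u)\in A$, and $0$ otherwise), the algorithm halts after at most $f(s)$ steps, where $s$ is the length of the input (the total number of binary digits of its entries plus the number of entries), and correctly answers whether $P$ can be completed to an acyclic local tournament. (Algorithms are programs of a random access machine that can load constants, add and subtract (truncated at $0$)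 registers, access its memory indirectly, and test for zero; each instruction and each test is one step.) -/

import Mathlib

/-! ## Oriented graphs and local tournaments -/

/-- An oriented graph: a digraph with no loops and with at most one arc joining any two vertices.
(The case `u = v` excludes loops.) -/
def IsOriented {V : Type} (D : Digraph V) : Prop :=
  ∀ u v, D.Adj u v → ¬ D.Adj v u

/-- The out-neighbourhood of `v`. -/
def outNbhd {V : Type} (D : Digraph V) (v : V) : Set V := {x | D.Adj v x}

/-- The in-neighbourhood of `v`. -/
def inNbhd {V : Type} (D : Digraph V) (v : V) : Set V := {x | D.Adj x v}

/-- The set `S` induces a tournament in the oriented graph `D`: any two distinct vertices of `S`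
are joined by an arc (by exactly one, as `D` is oriented). -/
def InducesTournament {V : Type} (D : Digraph V) (S : Set V) : Prop :=
  ∀ x ∈ S, ∀ y ∈ S, x ≠ y → D.Adj x y ∨ D.Adj y x

/-- A local tournament: an oriented graph in which the in-neighbourhood and the out-neighbourhood
of every vertex each induce a tournament. -/
def IsLocalTournament {V : Type} (D : Digraph V) : Prop :=
  IsOriented D ∧ ∀ v, InducesTournament D (inNbhd D v) ∧ InducesTournament D (outNbhd D v)

/-- A digraph is acyclic if it has no directed cycle, that is, if no nonempty directed walk
returns to its starting vertex. -/
def IsAcyclicDigraph {V : Type} (D : Digraph V) : Prop :=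
  ∀ v, ¬ Relation.TransGen D.Adj v v

/-- The class of acyclic local tournaments. -/
def IsAcyclicLocalTournament {V : Type} (D : Digraph V) : Prop :=
  IsLocalTournament D ∧ IsAcyclicDigraph D

/-! ## Partially oriented graphs and their completions -/

/-- A partially oriented graph: the edge-disjoint union of a simple graph (the edges) and an
oriented graph (the arcs) on the same vertex set. -/
structure PartiallyOrientedGraph (V : Type) where
  edges : SimpleGraph V
  arcs : Digraph V
  oriented : IsOriented arcs
  disjoint : ∀ u v, edges.Adj u v → ¬ arcs.Adj u v

/-- `D` is a completion of `P`: an oriented graph obtained from `P` by replacing each edge by an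
arc in one of the two possible ways (only one of the two, as `D` is oriented). -/
structure IsCompletion {V : Type} (P : PartiallyOrientedGraph V) (D : Digraph V) : Prop where
  oriented : IsOriented D
  arc_mem : ∀ u v, P.arcs.Adj u v → D.Adj u v
  edge_oriented : ∀ u v, P.edges.Adj u v → D.Adj u v ∨ D.Adj v u
  no_new : ∀ u v, D.Adj u v → P.arcs.Adj u v ∨ P.edges.Adj u v

/-- An instance of an orientation completion problem: a finite partially oriented graph, with
vertices numbered `0, …, n - 1`. -/
abbrev PogInstance : Type := (n : ℕ) × PartiallyOrientedGraph (Fin n)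

/-- The orientation completion problem for a class `C` of oriented graphs:
can the given partially oriented graph be completed to an oriented graph in `C`? -/
def OrientationCompletionProblem (C : ∀ n : ℕ, Digraph (Fin n) → Prop) (P : PogInstance) : Prop :=
  ∃ D : Digraph (Fin P.1), IsCompletion P.2 D ∧ C P.1 D

open Classical in
/-- The entry for the ordered pair `(u, v)` in the adjacency matrix of a partially oriented graph:
`1` for an edge `uv`, `2` for an arc `(u, v)`, `3` for an arc `(v, u)`, and `0` if `u` and `v` are
not adjacent. -/
noncomputable def PartiallyOrientedGraph.entry {V : Type} (P : PartiallyOrientedGraph V)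
    (u v : V) : ℕ :=
  if P.edges.Adj u v then 1 else if P.arcs.Adj u v then 2 else if P.arcs.Adj v u then 3 else 0

/-- The encoding of a partially oriented graph as an input of an algorithm: the number `n` of
vertices, followed by the adjacency matrix, row by row. -/
noncomputable def encodePog (P : PogInstance) : List ℕ :=
  P.1 :: List.ofFn fun k : Fin (P.1 * P.1) => P.2.entry k.divNat k.modNat

/-! ## Random access machines and polynomial time -/

namespace RAM

/-- Programs of a random access machine with registers and a memory, both holding natural numbers.
The elementary instructions are the loading of a constant, addition and truncated subtraction of
registers, and reading and writing the memory at an address held in a register; there is no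
multiplication. Control flow is by sequencing, by branching, and by loops, with tests for zero. -/
inductive Prog : Type
  /-- do nothing -/
  | skip : Prog
  /-- register `d` becomes the number `c` -/
  | const (d c : ℕ) : Prog
  /-- register `d` becomes register `a` plus register `b` -/
  | add (d a b : ℕ) : Prog
  /-- register `d` becomes register `a` minus register `b`, or `0` if this is negative -/
  | sub (d a b : ℕ) : Prog
  /-- register `d` becomes the memory cell whose address is in register `a` -/
  | load (d a : ℕ) : Prog
  /-- the memory cell whose address is in register `a` becomes register `b` -/
  | store (a b : ℕ) : Prog
  /-- `p`, then `q` -/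
  | seq (p q : Prog) : Prog
  /-- `p` if register `r` is nonzero, otherwise `q` -/
  | ite (r : ℕ) (p q : Prog) : Prog
  /-- repeat `p` as long as register `r` is nonzero -/
  | loop (r : ℕ) (p : Prog) : Prog

/-- A configuration: the contents of the registers and of the memory. -/
structure Config where
  reg : ℕ → ℕ
  mem : ℕ → ℕ

/-- Write `x` into register `d`. -/
def Config.setReg (s : Config) (d x : ℕ) : Config := { s with reg := Function.update s.reg d x }

/-- Write `x` into the memory cell with address `a`. -/
def Config.setMem (s : Config) (a x : ℕ) : Config := { s with mem := Function.update s.mem a x }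

/-- `Runs p s t s'`: started in the configuration `s`, the program `p` halts after exactly `t`
steps, in the configuration `s'`. Each elementary instruction and each test is one step.
(There is no multiplication, so in `t` steps the numbers grow by `O(t)` bits only, and this count
agrees with Turing machine time up to a polynomial.) -/
inductive Runs : Prog → Config → ℕ → Config → Prop
  | skip (s : Config) : Runs .skip s 1 s
  | const (s : Config) (d c : ℕ) : Runs (.const d c) s 1 (s.setReg d c)
  | add (s : Config) (d a b : ℕ) : Runs (.add d a b) s 1 (s.setReg d (s.reg a + s.reg b))
  | sub (s : Config) (d a b : ℕ) : Runs (.sub d a b) s 1 (s.setReg d (s.reg a - s.reg b))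
  | load (s : Config) (d a : ℕ) : Runs (.load d a) s 1 (s.setReg d (s.mem (s.reg a)))
  | store (s : Config) (a b : ℕ) : Runs (.store a b) s 1 (s.setMem (s.reg a) (s.reg b))
  | seq {p q : Prog} {s s' s'' : Config} {t t' : ℕ} :
      Runs p s t s' → Runs q s' t' s'' → Runs (.seq p q) s (t + t') s''
  | ite_true {r : ℕ} {p q : Prog} {s s' : Config} {t : ℕ} :
      s.reg r ≠ 0 → Runs p s t s' → Runs (.ite r p q) s (t + 1) s'
  | ite_false {r : ℕ} {p q : Prog} {s s' : Config} {t : ℕ} :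
      s.reg r = 0 → Runs q s t s' → Runs (.ite r p q) s (t + 1) s'
  | loop_done {r : ℕ} {p : Prog} {s : Config} :
      s.reg r = 0 → Runs (.loop r p) s 1 s
  | loop_step {r : ℕ} {p : Prog} {s s' s'' : Config} {t t' : ℕ} :
      s.reg r ≠ 0 → Runs p s t s' → Runs (.loop r p) s' t' s'' →
      Runs (.loop r p) s (t + t' + 1) s''

/-- The machine is deterministic: the number of steps and the final configuration are determined
by the program and the initial configuration. -/
theorem Runs.deterministic {p : Prog} {s s₁ : Config} {t₁ : ℕ} (h₁ : Runs p s t₁ s₁) :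
    ∀ {t₂ : ℕ} {s₂ : Config}, Runs p s t₂ s₂ → t₁ = t₂ ∧ s₁ = s₂ := by
  induction h₁ with
  | seq _ _ ih ih' =>
    intro t₂ s₂ h
    cases h with
    | seq a b =>
      obtain ⟨rfl, rfl⟩ := ih a
      obtain ⟨rfl, rfl⟩ := ih' b
      exact ⟨rfl, rfl⟩
  | ite_true hr _ ih =>
    intro t₂ s₂ h
    cases h with
    | ite_true _ a => obtain ⟨rfl, rfl⟩ := ih a; exact ⟨rfl, rfl⟩
    | ite_false hr' _ => exact absurd hr' hr
  | ite_false hr _ ih =>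
    intro t₂ s₂ h
    cases h with
    | ite_true hr' _ => exact absurd hr hr'
    | ite_false _ a => obtain ⟨rfl, rfl⟩ := ih a; exact ⟨rfl, rfl⟩
  | loop_done hr =>
    intro t₂ s₂ h
    cases h with
    | loop_done _ => exact ⟨rfl, rfl⟩
    | loop_step hr' _ _ => exact absurd hr hr'
  | loop_step hr _ _ ih ih' =>
    intro t₂ s₂ h
    cases h with
    | loop_done hr' => exact absurd hr' hr
    | loop_step _ a b =>
      obtain ⟨rfl, rfl⟩ := ih a
      obtain ⟨rfl, rfl⟩ := ih' b
      exact ⟨rfl, rfl⟩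
  | _ => intro t₂ s₂ h; cases h; exact ⟨rfl, rfl⟩

/-- The initial configuration on the input `l`: the entries of `l` are in the memory cells
`0, 1, …, l.length - 1`, the length of `l` is in register `0`, and everything else is `0`. -/
def inputConfig (l : List ℕ) : Config where
  reg := fun r => if r = 0 then l.length else 0
  mem := fun i => l.getD i 0

/-- The size of an input: the total number of binary digits of its entries, plus one for each
entry. -/
def inputSize (l : List ℕ) : ℕ := (l.map fun a => Nat.size a + 1).sum

/-- The decision problem `Q`, with instances encoded by `encode`, is solvable in polynomial time:
there are one program and one polynomial such that on every instance the program halts within the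
number of steps that the polynomial allows for the size of the input, with the answer `1` (yes) or
`0` (no) in register `0`. -/
def SolvableInPolyTime {α : Type} (encode : α → List ℕ) (Q : α → Prop) : Prop :=
  ∃ (p : Prog) (f : Polynomial ℕ), ∀ x : α, ∃ (t : ℕ) (s : Config),
    Runs p (inputConfig (encode x)) t s ∧
    t ≤ f.eval (inputSize (encode x)) ∧
    (Q x → s.reg 0 = 1) ∧ (¬ Q x → s.reg 0 = 0)

end RAM

/-! ## Straight orders -/

/-! Let `H` be the underlying graph. In an acyclic local tournament completing `P`, reachability is
a straight order of `H` (`IsCompletion.isStraightOrder`): it is total on components, and a vertex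
between two adjacent vertices is adjacent to both. Every straight order obeys local forcing rules:
besides transitivity, if `w` is a neighbour of `u` and `v ≠ u` is not adjacent to `u`, then `u` and
`w` lie on the same side of `v`. Conversely, an irreflexive relation that is closed under these
rules, contains the arcs and decides every edge gives a completion
(`IsForcingClosed.exists_completion`).

The algorithm closes the set of arcs under the rules, then repeatedly takes an undecided edge,
orients it arbitrarily and closes again. It never backtracks, and this is justified by
`IsForcingClosed.exists_straightOrder`: if a closed `R` lies in some straight order and does not
contain `(b, a)`, where `ab` is an edge, then it lies in a straight order with `a` before `b`. When
`a` and `b` are twins, it suffices to rearrange their twin class. Otherwise the whole component is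
reversed, up to the order inside twin classes. This does no harm, because all non-twin pairs of a
component force each other (`IsForcingClosed.of_not_twins`), so `R` contains none of them there.

Hence a completion exists exactly if the final relation has no loop. An extra rule spreads any loop
to all pairs, so a single entry of the relation matrix gives the answer. There are at most `n * n`
pairs, so `n * n` sweeps over all triples compute a closure, and the algorithm is a bounded nest of
loops over the vertices. -/

/-- A straight order of a graph: a strict order which is total on each connected component, does
not compare vertices of distinct components, and in which the vertices between two adjacent
vertices are adjacent to both. -/
structure IsStraightOrder {V : Type} (H : SimpleGraph V) (lt : V → V → Prop) : Prop where
  irrefl : ∀ x, ¬ lt x x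
  trans : ∀ x y z, lt x y → lt y z → lt x z
  reach : ∀ x y, lt x y → H.Reachable x y
  total : ∀ x y, H.Reachable x y → x ≠ y → lt x y ∨ lt y x
  umbrella : ∀ x y z, lt x y → lt y z → H.Adj x z → H.Adj x y ∧ H.Adj y z

/-- A relation closed under the rules by which pairs force each other in a straight order. -/
structure IsForcingClosed {V : Type} (H : SimpleGraph V) (R : V → V → Prop) : Prop where
  trans : ∀ x y z, R x y → R y z → R x z
  left : ∀ u v w, H.Adj u w → u ≠ v → ¬ H.Adj u v → (R u v ↔ R w v)
  right : ∀ u v w, H.Adj u w → u ≠ v → ¬ H.Adj u v → (R v u ↔ R v w)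

/-- Two vertices are twins if they have the same closed neighbourhood. -/
def AreTwins {V : Type} (H : SimpleGraph V) (x y : V) : Prop :=
  ∀ w, (x = w ∨ H.Adj x w) ↔ (y = w ∨ H.Adj y w)

section
variable {V : Type} {H : SimpleGraph V} {lt R : V → V → Prop}

/-! ### Twins and elementary properties of straight orders. -/

theorem AreTwins.symm {x y : V} (h : AreTwins H x y) : AreTwins H y x := fun w => (h w).symm

theorem AreTwins.trans {x y z : V} (h : AreTwins H x y) (h' : AreTwins H y z) :
    AreTwins H x z := fun w => (h w).trans (h' w)

theorem AreTwins.refl (x : V) : AreTwins H x x := fun _ => Iff.rfl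

theorem AreTwins.adj {x y : V} (h : AreTwins H x y) (hne : x ≠ y) : H.Adj x y := by
  have := (h y).2 (Or.inl rfl)
  tauto

theorem AreTwins.adj_left {x y w : V} (h : AreTwins H x y) (hw : H.Adj x w) (hne : y ≠ w) :
    H.Adj y w := by
  have := (h w).1 (Or.inr hw)
  tauto

theorem AreTwins.adj_right {x y w : V} (h : AreTwins H x y) (hw : H.Adj w x) (hne : y ≠ w) :
    H.Adj w y := (h.adj_left hw.symm hne).symm

theorem AreTwins.reachable {x y : V} (h : AreTwins H x y) : H.Reachable x y := by
  by_cases hne : x = y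
  · subst hne; exact SimpleGraph.Reachable.refl _
  · exact (h.adj hne).reachable

namespace IsStraightOrder

theorem asymm (h : IsStraightOrder H lt) {x y : V} (hxy : lt x y) : ¬ lt y x :=
  fun hyx => h.irrefl _ (h.trans _ _ _ hxy hyx)

theorem ne (h : IsStraightOrder H lt) {x y : V} (hxy : lt x y) : x ≠ y := by
  rintro rfl; exact h.irrefl _ hxy

theorem flip (h : IsStraightOrder H lt) : IsStraightOrder H (flip lt) where
  irrefl := h.irrefl
  trans x y z hxy hyz := h.trans z y x hyz hxy
  reach x y hxy := (h.reach y x hxy).symm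
  total x y hr hne := (h.total x y hr hne).symm
  umbrella x y z hxy hyz hxz := by
    have := h.umbrella z y x hyz hxy hxz.symm
    exact ⟨this.2.symm, this.1.symm⟩

/-- Otherwise `v` would lie between the adjacent vertices `u` and `w`, and the umbrella property
would make it adjacent to `u`. -/
theorem left_of (h : IsStraightOrder H lt) {u v w : V} (huw : H.Adj u w) (hne : u ≠ v)
    (huv : ¬ H.Adj u v) (hlt : lt u v) : lt w v := by
  have hwv : w ≠ v := by rintro rfl; exact huv huw
  rcases h.total w v (huw.symm.reachable.trans (h.reach _ _ hlt)) hwv with h1 | h1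
  · exact h1
  · exact absurd (h.umbrella u v w hlt h1 huw).1 huv

theorem left_of' (h : IsStraightOrder H lt) {u v w : V} (huw : H.Adj u w) (hne : u ≠ v)
    (huv : ¬ H.Adj u v) (hlt : lt w v) : lt u v := by
  rcases h.total u v (huw.reachable.trans (h.reach _ _ hlt)) hne with h1 | h1
  · exact h1
  · exact absurd (h.umbrella w v u hlt h1 huw.symm).2.symm huv

/-- A straight order is itself closed under the forcing rules. -/
theorem isForcingClosed (h : IsStraightOrder H lt) : IsForcingClosed H lt where
  trans := h.trans
  left _ _ _ huw hne huv := ⟨h.left_of huw hne huv, h.left_of' huw hne huv⟩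
  right _ _ _ huw hne huv := ⟨h.flip.left_of huw hne huv, h.flip.left_of' huw hne huv⟩

/-- Twin classes are convex. -/
theorem twins_of_between (h : IsStraightOrder H lt) {x y z : V} (hxz : AreTwins H x z)
    (hxy : lt x y) (hyz : lt y z) : AreTwins H x y := by
  have hlt := h.trans _ _ _ hxy hyz
  have hadj := hxz.adj (h.ne hlt)
  obtain ⟨axy, ayz⟩ := h.umbrella _ _ _ hxy hyz hadj
  intro w
  by_cases hwx : x = w
  · subst hwx; simp [axy.symm]
  by_cases hwy : y = w
  · subst hwy; simp [axy]
  by_cases hwz : z = w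
  · subst hwz; simp [hadj, ayz]
  simp only [hwx, hwy, false_or]
  constructor
  -- The vertex `w` is adjacent to both `x` and `z`. If `w` comes after `y`, then `y` lies between
  -- `x` and `w`; otherwise it lies between `w` and `z`.
  · intro hw
    have hzw : H.Adj z w := hxz.adj_left hw hwz
    rcases h.total y w (axy.symm.reachable.trans hw.reachable) hwy with h1 | h1
    · exact (h.umbrella _ _ _ hxy h1 hw).2
    · exact (h.umbrella _ _ _ h1 hyz hzw.symm).1.symm
  · intro hw
    rcases h.total x w (axy.reachable.trans hw.reachable) hwx with h1 | h1
    · rcases h.total z w (ayz.symm.reachable.trans hw.reachable) hwz with h2 | h2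
      · exact hxz.symm.adj_left (h.umbrella _ _ _ hyz h2 hw).2 hwx
      · exact (h.umbrella _ _ _ h1 h2 hadj).1
    · exact (h.umbrella _ _ _ h1 hxy hw.symm).1.symm

end IsStraightOrder

/-! ### How pairs of one component force each other. -/

theorem IsForcingClosed.flip (hR : IsForcingClosed H R) : IsForcingClosed H (flip R) where
  trans x y z hxy hyz := hR.trans z y x hyz hxy
  left u v w := hR.right u v w
  right u v w := hR.left u v w

/-- The left end is moved along a walk of `H` from `x` to `z`, looking only at the vertices that are
not after `x`. By the umbrella property none of these is adjacent to `y`, so the left rule applies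
to each step between two of them. An edge that returns from beyond `x` to a vertex before `x` spans
`x`, so its left end is a neighbour of `x` and the rule applies from `x` directly. -/
theorem IsForcingClosed.left_iff_of_lt (hR : IsForcingClosed H R) (h : IsStraightOrder H lt)
    {x y z : V} (hxy : lt x y) (hadj : ¬ H.Adj x y) (hzx : lt z x) : R z y ↔ R x y := by
  have key : ∀ z, Relation.ReflTransGen H.Adj x z → (lt z x ∨ z = x) → (R z y ↔ R x y) := by
    intro z hz
    induction hz with
    | refl => intro; rfl
    | @tail b c _ hbc ih =>
      rintro (hcx | rfl)
      · by_cases hb : lt b x ∨ b = x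
        · rw [← ih hb]
          refine (hR.left b y c hbc ?_ ?_).symm
          · rintro rfl
            rcases hb with hb | rfl
            · exact h.asymm hxy hb
            · exact h.irrefl _ hxy
          · intro hby
            rcases hb with hb | rfl
            · exact hadj (h.umbrella _ _ _ hb hxy hby).2
            · exact hadj hby
        · push Not at hb
          have hxb : lt x b := by
            have := h.total x b ((h.reach _ _ hcx).symm.trans hbc.symm.reachable) hb.2.symm
            tauto
          have := (h.umbrella _ _ _ hcx hxb hbc.symm).1
          exact (hR.left x y c this.symm (h.ne hxy) hadj).symm
      · rfl
  refine key z ?_ (Or.inl hzx)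
  exact (SimpleGraph.reachable_iff_reflTransGen _ _).1 (h.reach _ _ hzx).symm

theorem IsForcingClosed.right_iff_of_lt (hR : IsForcingClosed H R) (h : IsStraightOrder H lt)
    {x y z : V} (hxy : lt x y) (hadj : ¬ H.Adj x y) (hyz : lt y z) : R x z ↔ R x y :=
  hR.flip.left_iff_of_lt h.flip (x := y) (y := x) hxy (fun e => hadj e.symm) hyz

/-- A nonadjacent pair stays nonadjacent when its ends move outwards, so the two ends can be moved
one after the other. -/
theorem IsForcingClosed.iff_extremes (hR : IsForcingClosed H R) (h : IsStraightOrder H lt)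
    {x y a b : V} (hxy : lt x y) (hadj : ¬ H.Adj x y) (hax : lt a x ∨ a = x)
    (hyb : lt y b ∨ b = y) : R a b ↔ R x y := by
  have hay : lt a y ∧ ¬ H.Adj a y ∧ (R a y ↔ R x y) := by
    rcases hax with hax | rfl
    · exact ⟨h.trans _ _ _ hax hxy, fun e => hadj (h.umbrella _ _ _ hax hxy e).2,
        hR.left_iff_of_lt h hxy hadj hax⟩
    · exact ⟨hxy, hadj, Iff.rfl⟩
  rw [← hay.2.2]
  rcases hyb with hyb | rfl
  · exact hR.right_iff_of_lt h hay.1 hay.2.1 hyb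
  · rfl

/-- All nonadjacent pairs of a component force each other. -/
theorem IsForcingClosed.of_not_adj (hR : IsForcingClosed H R) (h : IsStraightOrder H lt)
    {x y x' y' : V} (hxy : lt x y) (hadj : ¬ H.Adj x y) (hxy' : lt x' y') (hadj' : ¬ H.Adj x' y')
    (hreach : H.Reachable x x') (hxyR : R x y) : R x' y' := by
  -- The earlier of `x`, `x'` and the later of `y`, `y'` form a pair that is equivalent to both
  -- given pairs.
  obtain ⟨a, ha, ha'⟩ : ∃ a, (lt a x ∨ a = x) ∧ (lt a x' ∨ a = x') := by
    by_cases e : x = x'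
    · exact ⟨x, Or.inr rfl, Or.inr e⟩
    · rcases h.total _ _ hreach e with e | e
      · exact ⟨x, Or.inr rfl, Or.inl e⟩
      · exact ⟨x', Or.inl e, Or.inr rfl⟩
  obtain ⟨b, hb, hb'⟩ : ∃ b, (lt y b ∨ b = y) ∧ (lt y' b ∨ b = y') := by
    by_cases e : y = y'
    · exact ⟨y, Or.inr rfl, Or.inr e⟩
    · rcases h.total _ _ (((h.reach _ _ hxy).symm.trans hreach).trans (h.reach _ _ hxy')) e
        with e | e
      · exact ⟨y', Or.inl e, Or.inr rfl⟩
      · exact ⟨y, Or.inr rfl, Or.inl e⟩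
  exact (hR.iff_extremes h hxy' hadj' ha' hb').1 ((hR.iff_extremes h hxy hadj ha hb).2 hxyR)

/-- Each pair which is not a pair of twins is equivalent to a nonadjacent pair. -/
theorem exists_not_adj_equiv {x y : V} (hne : x ≠ y) (ht : ¬ AreTwins H x y) :
    ∃ x' y', x' ≠ y' ∧ ¬ H.Adj x' y' ∧ (H.Reachable x y → H.Reachable x x') ∧
      ∀ S : V → V → Prop, IsForcingClosed H S → (S x y ↔ S x' y') := by
  by_cases hadj : H.Adj x y
  · unfold AreTwins at ht
    push Not at ht
    -- The vertex `w` lies in exactly one of the two closed neighbourhoods. One rule replaces the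
    -- end that sees `w` by `w`, and the new pair is nonadjacent.
    obtain ⟨w, ⟨h1, h2⟩ | ⟨h1, h2⟩⟩ := ht
    · have hxw : H.Adj x w := by
        rcases h1 with rfl | h1
        · exact absurd hadj.symm h2.2
        · exact h1
      exact ⟨w, y, h2.1.symm, fun e => h2.2 e.symm, fun _ => hxw.reachable,
        fun S hS => (hS.left w y x hxw.symm h2.1.symm (fun e => h2.2 e.symm)).symm⟩
    · have hyw : H.Adj y w := by
        rcases h2 with rfl | h2
        · exact absurd hadj h1.2
        · exact h2
      exact ⟨x, w, h1.1, h1.2, fun _ => SimpleGraph.Reachable.refl _,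
        fun S hS => (hS.right w x y hyw.symm h1.1.symm (fun e => h1.2 e.symm)).symm⟩
  · exact ⟨x, y, hne, hadj, fun _ => SimpleGraph.Reachable.refl _, fun S hS => Iff.rfl⟩

/-- Both pairs are replaced by equivalent nonadjacent ones. The equivalence holds for every closed
relation, so it is used for `R` and also for `lt`, which places the new pairs in the right order. -/
theorem IsForcingClosed.of_not_twins (hR : IsForcingClosed H R) (h : IsStraightOrder H lt)
    {x y x' y' : V} (hxy : lt x y) (ht : ¬ AreTwins H x y) (hxy' : lt x' y')
    (ht' : ¬ AreTwins H x' y') (hreach : H.Reachable x x') (hxyR : R x y) : R x' y' := by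
  obtain ⟨p, q, -, hadj, hr, hpq⟩ := exists_not_adj_equiv (h.ne hxy) ht
  obtain ⟨p', q', -, hadj', hr', hpq'⟩ := exists_not_adj_equiv (h.ne hxy') ht'
  refine (hpq' R hR).2 (hR.of_not_adj h ((hpq lt h.isForcingClosed).1 hxy) hadj
    ((hpq' lt h.isForcingClosed).1 hxy') hadj' ?_ ((hpq R hR).1 hxyR))
  exact ((hr (h.reach _ _ hxy)).symm.trans hreach).trans (hr' (h.reach _ _ hxy'))

/-! ### Changing a straight order. -/

/-- Within the twin class of `a`, put the set `U` last. -/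
theorem IsStraightOrder.move_last (h : IsStraightOrder H lt) (a : V) (U : V → Prop) :
    IsStraightOrder H fun x y => (AreTwins H a x ∧ AreTwins H a y ∧
      ((¬ U x ∧ U y) ∨ ((U x ↔ U y) ∧ lt x y))) ∨
      (¬ (AreTwins H a x ∧ AreTwins H a y) ∧ lt x y) where
  irrefl x := by simp [h.irrefl x]
  reach x y := by
    rintro (⟨hx, hy, -⟩ | ⟨-, hlt⟩)
    · exact (hx.symm.trans hy).reachable
    · exact h.reach _ _ hlt
  total x y hr hne := by
    have := h.total x y hr hne
    generalize AreTwins H a x = p, AreTwins H a y = q, lt x y = r, lt y x = s at *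
    by_cases p <;> by_cases q <;> by_cases U x <;> by_cases U y <;> simp_all
  trans x y z hxy hyz := by
    -- Here `t1`, `t2`, `t3` express the convexity of the twin class, and `t4`, `t5` compare `x`
    -- with `z`, which lie in one component. With these facts the case split over membership in the
    -- class is propositional.
    have t1 : AreTwins H a x → AreTwins H a y → lt z x → lt y z → AreTwins H a z := fun p q r s =>
      q.trans (h.twins_of_between (q.symm.trans p) s r)
    have t2 : AreTwins H a y → AreTwins H a z → lt x y → lt z x → AreTwins H a x := fun p q r s =>
      q.trans (h.twins_of_between (q.symm.trans p) s r)
    have t3 : AreTwins H a x → AreTwins H a z → lt x y → lt y z → AreTwins H a y := fun p q r s =>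
      p.trans (h.twins_of_between (p.symm.trans q) r s)
    have t4 : AreTwins H a x → AreTwins H a y → lt y z → lt x z ∨ x = z ∨ lt z x := fun p q r => by
      by_cases e : x = z
      · exact Or.inr (Or.inl e)
      · exact (h.total x z ((p.symm.trans q).reachable.trans (h.reach _ _ r)) e).imp_right Or.inr
    have t5 : AreTwins H a y → AreTwins H a z → lt x y → lt x z ∨ x = z ∨ lt z x := fun p q r => by
      by_cases e : x = z
      · exact Or.inr (Or.inl e)
      · exact (h.total x z ((h.reach _ _ r).trans (p.symm.trans q).reachable) e).imp_right Or.inr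
    revert t1 t2 t3 t4 t5 hxy hyz
    by_cases hx : AreTwins H a x <;> by_cases hy : AreTwins H a y <;>
      by_cases hz : AreTwins H a z <;>
      simp only [hx, hy, hz, true_and, and_true, false_and, and_false, not_true_eq_false,
        not_false_eq_true, or_false, false_or, forall_const, false_imp_iff, imp_false]
    · intro hxy hyz _ _
      have := h.trans x y z
      tauto
    · intro hxy hyz t t'
      rcases t' hyz with e | rfl | e
      · exact e
      · exact absurd hx hz
      · exact absurd hyz (t e)
    · exact fun hxy hyz t => absurd hyz (t hxy)
    · exact h.trans _ _ _
    · intro hxy hyz t t'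
      rcases t' hxy with e | rfl | e
      · exact e
      · exact absurd hz hx
      · exact absurd e (t hxy)
    all_goals exact h.trans _ _ _
  umbrella x y z hxy hyz hxz := by
    have hxyz := h.umbrella x y z
    have t3 : AreTwins H a x → AreTwins H a z → lt x y → lt y z → AreTwins H a y := fun p q r s =>
      p.trans (h.twins_of_between (p.symm.trans q) r s)
    have nxy : x ≠ y := by rintro rfl; simp [h.irrefl x] at hxy
    have nyz : y ≠ z := by rintro rfl; simp [h.irrefl y] at hyz
    have s1 : AreTwins H a x → AreTwins H a y → H.Adj x y ∧ H.Adj y z := fun p q =>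
      ⟨(p.symm.trans q).adj nxy, (p.symm.trans q).adj_left hxz nyz⟩
    have s2 : AreTwins H a y → AreTwins H a z → H.Adj x y ∧ H.Adj y z := fun p q =>
      ⟨(q.symm.trans p).adj_right hxz nxy.symm, (p.symm.trans q).adj nyz⟩
    by_cases hx : AreTwins H a x <;> by_cases hy : AreTwins H a y
    · exact s1 hx hy
    · by_cases hz : AreTwins H a z
      · simp only [hx, hy, hz, true_and, and_true, false_and, and_false,
          not_false_eq_true, false_or] at hxy hyz
        exact absurd (t3 hx hz hxy hyz) hy
      · exact hxyz (by simpa [hx, hy] using hxy) (by simpa [hy, hz] using hyz) hxz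
    · by_cases hz : AreTwins H a z
      · exact s2 hy hz
      · exact hxyz (by simpa [hx, hy] using hxy) (by simpa [hy, hz] using hyz) hxz
    · exact hxyz (by simpa [hx] using hxy) (by simpa [hy] using hyz) hxz

/-- Reverse the component of `a`, keeping the order within the twin classes. -/
theorem IsStraightOrder.reverse_component (h : IsStraightOrder H lt) (a : V) :
    IsStraightOrder H fun x y => (H.Reachable a x ∧ ¬ AreTwins H x y ∧ lt y x) ∨
      ((H.Reachable a x → AreTwins H x y) ∧ lt x y) where
  irrefl x := by simp [h.irrefl x]
  reach x y := by
    rintro (⟨-, -, hlt⟩ | ⟨-, hlt⟩)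
    · exact (h.reach _ _ hlt).symm
    · exact h.reach _ _ hlt
  total x y hr hne := by
    have := h.total x y hr hne
    have e : H.Reachable a x ↔ H.Reachable a y := ⟨fun p => p.trans hr, fun p => p.trans hr.symm⟩
    have e' : AreTwins H x y ↔ AreTwins H y x := ⟨AreTwins.symm, AreTwins.symm⟩
    rw [e, e']
    clear hr e e'
    generalize H.Reachable a y = p, AreTwins H y x = q, lt x y = r, lt y x = s at *
    by_cases p <;> by_cases q <;> simp_all; tauto
  trans x y z hxy hyz := by
    have rxy : H.Reachable x y := by
      rcases hxy with e | e
      · exact (h.reach _ _ e.2.2).symm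
      · exact h.reach _ _ e.2
    have ryz : H.Reachable y z := by
      rcases hyz with e | e
      · exact (h.reach _ _ e.2.2).symm
      · exact h.reach _ _ e.2
    have e : H.Reachable a x ↔ H.Reachable a y := ⟨fun p => p.trans rxy, fun p => p.trans rxy.symm⟩
    by_cases hx : H.Reachable a x
    · have hy := e.1 hx
      simp only [hx, hy, true_and, true_imp_iff] at hxy hyz ⊢
      -- In the two mixed cases one pair is reversed and the other is a pair of twins. If `x` came
      -- before `z` in the old order, convexity of twin classes would make the reversed pair twins.
      rcases hxy with ⟨p, q⟩ | ⟨p, q⟩ <;> rcases hyz with ⟨p', q'⟩ | ⟨p', q'⟩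
      · exact Or.inl ⟨fun t => p (t.trans (h.twins_of_between t.symm q' q)), h.trans _ _ _ q' q⟩
      · refine Or.inl ⟨fun t => p (t.trans p'.symm), ?_⟩
        rcases h.total x z (rxy.trans ryz) (by rintro rfl; exact p p'.symm) with r | r
        · exact absurd ((h.twins_of_between p' q r).symm) p
        · exact r
      · refine Or.inl ⟨fun t => p' (p.symm.trans t), ?_⟩
        rcases h.total x z (rxy.trans ryz) (by rintro rfl; exact p' p.symm) with r | r
        · exact absurd (p.symm.trans (h.twins_of_between p r q')) p'
        · exact r
      · exact Or.inr ⟨p.trans p', h.trans _ _ _ q q'⟩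
    · have hy := fun t => hx (e.2 t)
      have := h.trans x y z
      tauto
  umbrella x y z hxy hyz hxz := by
    have nxy : x ≠ y := by rintro rfl; simp [h.irrefl x] at hxy
    have nyz : y ≠ z := by rintro rfl; simp [h.irrefl y] at hyz
    have rxy : H.Reachable x y := by
      rcases hxy with e | e
      · exact (h.reach _ _ e.2.2).symm
      · exact h.reach _ _ e.2
    have e : H.Reachable a x ↔ H.Reachable a y := ⟨fun p => p.trans rxy, fun p => p.trans rxy.symm⟩
    have s1 : AreTwins H x y → H.Adj x y ∧ H.Adj y z := fun p =>
      ⟨p.adj nxy, p.adj_left hxz nyz⟩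
    have s2 : AreTwins H y z → H.Adj x y ∧ H.Adj y z := fun p =>
      ⟨p.symm.adj_right hxz nxy.symm, p.adj nyz⟩
    have s3 := h.umbrella x y z
    have s4 := h.flip.umbrella x y z
    unfold _root_.flip at s4
    tauto

/-- A straight order extending a closed relation can be changed so as to orient an undecided edge
in any prescribed way. -/
theorem IsForcingClosed.exists_straightOrder (hR : IsForcingClosed H R)
    (h : IsStraightOrder H lt) (hsub : ∀ x y, R x y → lt x y) {a b : V} (hab : H.Adj a b)
    (hba : ¬ R b a) :
    ∃ lt', IsStraightOrder H lt' ∧ (∀ x y, R x y → lt' x y) ∧ lt' a b := by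
  rcases h.total a b hab.reachable hab.ne with hlt | hlt
  · exact ⟨lt, h, hsub, hlt⟩
  by_cases ht : AreTwins H a b
  -- The set moved last consists of `b` and all that `R` puts after `b`. It is closed upwards under
  -- `R`, so no pair of `R` is broken, and it omits `a` because `R b a` fails.
  · refine ⟨_, h.move_last a fun x => x = b ∨ R b x, fun x y hxy => ?_, ?_⟩
    · have := hsub _ _ hxy
      have h1 : R b x → R b y := fun e => hR.trans _ _ _ e hxy
      have h2 : x = b → R b y := by rintro rfl; exact hxy
      tauto
    · exact Or.inl ⟨AreTwins.refl a, ht, Or.inl ⟨by have := hab.ne; tauto, Or.inl rfl⟩⟩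
  · refine ⟨_, h.reverse_component a, fun x y hxy => ?_, ?_⟩
    · refine Or.inr ⟨fun hx => ?_, hsub _ _ hxy⟩
      -- A non-twin pair of `R` in this component would force the pair `(b, a)`, which is also a
      -- non-twin pair of `lt`.
      by_contra hxt
      exact hba (hR.of_not_twins h (hsub _ _ hxy) hxt hlt (fun t => ht t.symm)
        (hx.symm.trans hab.reachable) hxy)
    · exact Or.inl ⟨SimpleGraph.Reachable.refl _, ht, hlt⟩

end

/-! ## Acyclic local tournaments and straight orders -/

/-- The underlying graph of a partially oriented graph. -/
def PartiallyOrientedGraph.underlying {V : Type} (P : PartiallyOrientedGraph V) :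
    SimpleGraph V where
  Adj u v := P.edges.Adj u v ∨ P.arcs.Adj u v ∨ P.arcs.Adj v u
  symm := ⟨fun u v h => by have := P.edges.adj_comm u v; tauto⟩
  loopless := ⟨fun u h => by
    have := P.oriented u u
    have := P.edges.loopless.irrefl u
    tauto⟩

section
variable {V : Type}

/-- The digraph with all arcs reversed. -/
def reverseDigraph (D : Digraph V) : Digraph V := ⟨fun x y => D.Adj y x⟩

theorem transGen_reverseDigraph {D : Digraph V} {x y : V} :
    Relation.TransGen (reverseDigraph D).Adj x y ↔ Relation.TransGen D.Adj y x :=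
  Relation.transGen_swap

theorem IsAcyclicLocalTournament.reverse {D : Digraph V} (hD : IsAcyclicLocalTournament D) :
    IsAcyclicLocalTournament (reverseDigraph D) := by
  refine ⟨⟨fun u v h => hD.1.1 v u h, fun v => ⟨fun x hx y hy hne => ?_, fun x hx y hy hne => ?_⟩⟩,
    fun v hv => hD.2 v (transGen_reverseDigraph.1 hv)⟩
  · exact ((hD.1.2 v).2 x hx y hy hne).symm
  · exact ((hD.1.2 v).1 x hx y hy hne).symm

open Relation in
-- The last vertex of the walk before its end and `y` share an out-neighbour, so they are equal or
-- joined by an arc. If the arc leaves `y`, the walk can be shortened.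
theorem IsAcyclicLocalTournament.comparable_of_lt {D : Digraph V}
    (hD : IsAcyclicLocalTournament D) {x w y : V} (hxw : TransGen D.Adj x w) (hyw : D.Adj y w) :
    x = y ∨ TransGen D.Adj x y ∨ TransGen D.Adj y x := by
  induction hxw with
  | @single b h =>
    by_cases e : x = y
    · exact Or.inl e
    · rcases (hD.1.2 b).1 x h y hyw e with h | h
      · exact Or.inr (Or.inl (.single h))
      · exact Or.inr (Or.inr (.single h))
  | @tail b c hxb hbc ih =>
    by_cases e : b = y
    · exact Or.inr (Or.inl (e ▸ hxb))
    · rcases (hD.1.2 c).1 b hbc y hyw e with h | h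
      · exact Or.inr (Or.inl (hxb.tail h))
      · exact ih h

open Relation in
-- The tail of the arc into `z` slides along the walk from `x` to `y`: the next vertex and `z` share
-- an in-neighbour, hence are joined, and acyclicity fixes the direction.
theorem IsAcyclicLocalTournament.adj_of_between {D : Digraph V}
    (hD : IsAcyclicLocalTournament D) {x y z : V} (hxy : TransGen D.Adj x y)
    (hyz : TransGen D.Adj y z) (hxz : D.Adj x z) : D.Adj y z := by
  induction hxy using TransGen.head_induction_on with
  | @single a h =>
    rcases (hD.1.2 a).2 y h z hxz (by rintro rfl; exact hD.2 _ hyz) with e | e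
    · exact e
    · exact absurd (hyz.tail e) (hD.2 _)
  | @head a c h hcy ih =>
    refine ih ?_
    have hcz := hcy.trans hyz
    rcases (hD.1.2 a).2 c h z hxz (by rintro rfl; exact hD.2 _ hcz) with e | e
    · exact e
    · exact absurd (hcz.tail e) (hD.2 _)

variable {P : PartiallyOrientedGraph V} {D : Digraph V}

theorem IsCompletion.adj_iff (hP : IsCompletion P D) (x y : V) :
    P.underlying.Adj x y ↔ D.Adj x y ∨ D.Adj y x := by
  have h1 := hP.arc_mem x y
  have h2 := hP.arc_mem y x
  have h3 := hP.edge_oriented x y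
  have h4 := hP.no_new x y
  have h5 := hP.no_new y x
  have h6 := P.edges.adj_comm x y
  change P.edges.Adj x y ∨ P.arcs.Adj x y ∨ P.arcs.Adj y x ↔ _
  tauto

open Relation in
/-- The reachability relation of an acyclic local tournament is a straight order. -/
theorem IsCompletion.isStraightOrder (hP : IsCompletion P D) (hD : IsAcyclicLocalTournament D) :
    IsStraightOrder P.underlying (TransGen D.Adj) where
  irrefl := hD.2
  trans _ _ _ := TransGen.trans
  reach x y h := by
    induction h with
    | single h => exact SimpleGraph.Adj.reachable ((hP.adj_iff _ _).2 (Or.inl h))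
    | tail _ h ih => exact ih.trans (SimpleGraph.Adj.reachable ((hP.adj_iff _ _).2 (Or.inl h)))
  total x y h hne := by
    have key : x = y ∨ TransGen D.Adj x y ∨ TransGen D.Adj y x := by
      rw [SimpleGraph.reachable_iff_reflTransGen] at h
      clear hne
      induction h with
      | refl => exact Or.inl rfl
      | @tail b c _ hbc ih =>
        rcases (hP.adj_iff _ _).1 hbc with e | e <;> rcases ih with rfl | ih | ih
        · exact Or.inr (Or.inl (.single e))
        · exact Or.inr (Or.inl (ih.tail e))
        · have := hD.reverse.comparable_of_lt (transGen_reverseDigraph.2 ih) (y := c) e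
          rw [transGen_reverseDigraph, transGen_reverseDigraph] at this
          tauto
        · exact Or.inr (Or.inr (.single e))
        · exact hD.comparable_of_lt ih e
        · exact Or.inr (Or.inr (.head e ih))
    tauto
  umbrella x y z hxy hyz hxz := by
    rw [hP.adj_iff] at hxz
    have hxz : D.Adj x z := by
      rcases hxz with e | e
      · exact e
      · exact absurd ((hxy.trans hyz).tail e) (hD.2 _)
    have h1 := hD.adj_of_between hxy hyz hxz
    have h2 : D.Adj x y := hD.reverse.adj_of_between (x := z) (y := y) (z := x)
      (transGen_reverseDigraph.2 hyz) (transGen_reverseDigraph.2 hxy) hxz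
    exact ⟨(hP.adj_iff _ _).2 (Or.inl h2), (hP.adj_iff _ _).2 (Or.inl h1)⟩

/-- A closed irreflexive relation which orients every edge yields a completion to an acyclic local
tournament. -/
theorem IsForcingClosed.exists_completion {R : V → V → Prop}
    (hR : IsForcingClosed P.underlying R) (hirr : ∀ x, ¬ R x x)
    (htot : ∀ x y, P.underlying.Adj x y → R x y ∨ R y x) (harc : ∀ x y, P.arcs.Adj x y → R x y) :
    ∃ D, IsCompletion P D ∧ IsAcyclicLocalTournament D := by
  have hor : ∀ u v, R u v → ¬ R v u := fun u v h h' => hirr u (hR.trans _ _ _ h h')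
  refine ⟨⟨fun x y => P.underlying.Adj x y ∧ R x y⟩, ⟨fun u v h h' => hor _ _ h.2 h'.2,
    fun u v h => ⟨Or.inr (Or.inl h), harc _ _ h⟩, fun u v h => ?_, fun u v h => ?_⟩,
    ⟨fun u v h h' => hor _ _ h.2 h'.2, fun v => ⟨?_, ?_⟩⟩, fun v h => ?_⟩
  · rcases htot u v (Or.inl h) with e | e
    · exact Or.inl ⟨Or.inl h, e⟩
    · exact Or.inr ⟨Or.inl h.symm, e⟩
  · rcases h.1 with e | e | e
    · exact Or.inr e
    · exact Or.inl e
    · exact absurd (harc _ _ e) (hor _ _ h.2)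
  · rintro x ⟨hxv, rxv⟩ y ⟨hyv, ryv⟩ hne
    by_cases e : P.underlying.Adj x y
    · rcases htot x y e with r | r
      · exact Or.inl ⟨e, r⟩
      · exact Or.inr ⟨e.symm, r⟩
    -- If `x` and `y` were nonadjacent, the right rule would turn `R x v` into `R x y`, and the left
    -- rule would turn this into `R v y`, against `R y v`.
    · have := (hR.right y x v hyv hne.symm (fun t => e t.symm)).2 rxv
      have := (hR.left x y v hxv hne e).1 this
      exact absurd this (hor _ _ ryv)
  · rintro x ⟨hxv, rxv⟩ y ⟨hyv, ryv⟩ hne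
    by_cases e : P.underlying.Adj x y
    · rcases htot x y e with r | r
      · exact Or.inl ⟨e, r⟩
      · exact Or.inr ⟨e.symm, r⟩
    · have := (hR.left x y v hxv.symm hne e).2 ryv
      have := (hR.right y x v hyv.symm hne.symm (fun t => e t.symm)).1 this
      exact absurd this (hor _ _ rxv)
  · refine hirr v ?_
    have : ∀ x y, Relation.TransGen (fun x y => P.underlying.Adj x y ∧ R x y) x y → R x y := by
      intro x y h
      induction h with
      | single h => exact h.2
      | tail _ h ih => exact hR.trans _ _ _ ih h.2
    exact this v v h

end

/-! ## The forcing algorithm -/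

section
variable {α : Type} {n : ℕ}

/-- Apply `f (c - 1)`, then `f (c - 2)`, …, then `f 0`. -/
def downFold (f : Fin n → α → α) : ∀ c, c ≤ n → α → α
  | 0, _, a => a
  | c + 1, h, a => downFold f c (Nat.le_of_succ_le h) (f ⟨c, h⟩ a)

/-- Apply `f (n - 1)`, then `f (n - 2)`, …, then `f 0`. -/
def forEach (f : Fin n → α → α) : α → α := downFold f n le_rfl

theorem downFold_induction {f : Fin n → α → α} {p : α → Prop} (hf : ∀ i a, p a → p (f i a)) :
    ∀ c h a, p a → p (downFold f c h a)
  | 0, _, _, ha => ha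
  | c + 1, h, a, ha => downFold_induction hf c _ _ (hf ⟨c, h⟩ a ha)

theorem forEach_induction {f : Fin n → α → α} {p : α → Prop} (hf : ∀ i a, p a → p (f i a))
    {a : α} (ha : p a) : p (forEach f a) := downFold_induction hf n le_rfl a ha

theorem downFold_const (f : α → α) : ∀ c (h : c ≤ n) a, downFold (fun _ => f) c h a = f^[c] a
  | 0, _, _ => rfl
  | c + 1, _, a => downFold_const f c _ (f a)

theorem forEach_const (f : α → α) : forEach (fun _ : Fin n => f) = f^[n] :=
  funext (downFold_const f n le_rfl)

/-- A function on a preorder is inflationary if it takes no element to a smaller one. -/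
def Inflationary [Preorder α] (f : α → α) : Prop := ∀ a, a ≤ f a

theorem Inflationary.forEach [Preorder α] {f : Fin n → α → α} (hf : ∀ i, Inflationary (f i)) :
    Inflationary (forEach f) :=
  fun a => forEach_induction (p := fun b => a ≤ b) (fun i b hb => hb.trans (hf i b)) le_rfl

theorem Inflationary.comp [Preorder α] {f g : α → α} (hg : Inflationary g) (hf : Inflationary f) :
    Inflationary fun a => g (f a) := fun a => (hf a).trans (hg _)

theorem Inflationary.of_comp_le [PartialOrder α] {f g : α → α} (hg : Inflationary g)
    (hf : Inflationary f) {a : α} (h : g (f a) ≤ a) : f a ≤ a ∧ g a ≤ a := by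
  have h1 : f a ≤ a := (hg _).trans h
  have h2 : f a = a := le_antisymm h1 (hf a)
  rw [h2] at h
  exact ⟨h1, h⟩

/-- Here `b` is the intermediate value to which `f i` is applied; all later steps only enlarge the
result. -/
theorem exists_stage_downFold [Preorder α] {f : Fin n → α → α} (hf : ∀ i, Inflationary (f i))
    (i : Fin n) : ∀ (c : ℕ) (h : c ≤ n) (a : α), (i : ℕ) < c → ∃ b, a ≤ b ∧ f i b ≤ downFold f c h a
  | 0, _, _, hi => absurd hi (Nat.not_lt_zero _)
  | c + 1, h, a, hi => by
    by_cases hic : (i : ℕ) = c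
    · refine ⟨a, le_rfl, ?_⟩
      have : i = ⟨c, h⟩ := Fin.ext hic
      subst this
      exact downFold_induction (p := fun b => f ⟨c, h⟩ a ≤ b) (fun i b hb => hb.trans (hf i b))
        c _ _ le_rfl
    · obtain ⟨b, hb, hb'⟩ := exists_stage_downFold hf i c (Nat.le_of_succ_le h) (f ⟨c, h⟩ a)
        (by omega)
      exact ⟨b, (hf _ _).trans hb, hb'⟩

theorem exists_stage_forEach [Preorder α] {f : Fin n → α → α} (hf : ∀ i, Inflationary (f i))
    (i : Fin n) (a : α) : ∃ b, a ≤ b ∧ f i b ≤ forEach f a :=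
  exists_stage_downFold hf i n le_rfl a i.2

theorem le_of_forEach_le [PartialOrder α] {f : Fin n → α → α} (hf : ∀ i, Inflationary (f i))
    {a : α} (h : forEach f a ≤ a) (i : Fin n) : f i a ≤ a := by
  obtain ⟨b, hb, hb'⟩ := exists_stage_forEach hf i a
  have : b = a := le_antisymm ((hf i b).trans (hb'.trans h)) hb
  subst this
  exact hb'.trans h

/-- If step `N` still enlarged the set, no earlier step could have stalled, and after `N + 1` strict
enlargements the set would have more elements than the type. -/
theorem Inflationary.iterate_stable [Fintype α] {f : Finset α → Finset α} (hf : Inflationary f)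
    (s : Finset α) {N : ℕ} (hN : Fintype.card α ≤ N) : f (f^[N] s) ≤ f^[N] s := by
  by_contra hcon
  have hne : ∀ k ≤ N, f^[k] s < f^[k + 1] s := by
    intro k hk
    rw [Function.iterate_succ_apply']
    refine lt_of_le_of_ne (hf _) fun e => hcon ?_
    have : f^[N] s = f^[k] s := by
      obtain ⟨m, rfl⟩ := Nat.exists_eq_add_of_le' hk
      rw [Function.iterate_add_apply]
      exact Function.iterate_fixed e.symm m
    rw [this, ← e]
  have hcard : ∀ k ≤ N + 1, k ≤ (f^[k] s).card := by
    intro k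
    induction k with
    | zero => intro _; exact Nat.zero_le _
    | succ k ih =>
      intro hk
      have := Finset.card_lt_card (hne k (by omega))
      have := ih (by omega)
      omega
  have h1 := hcard (N + 1) le_rfl
  have h2 := Finset.card_le_univ (f^[N + 1] s)
  omega

open Classical in
/-- Apply `f` if the condition `c` holds. -/
noncomputable def applyIf (c : α → Prop) (f : α → α) : α → α := fun a => if c a then f a else a

theorem applyIf_pos {c : α → Prop} {a : α} (f : α → α) (h : c a) : applyIf c f a = f a :=
  if_pos h

theorem applyIf_neg {c : α → Prop} {a : α} (f : α → α) (h : ¬ c a) : applyIf c f a = a :=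
  if_neg h

theorem Inflationary.applyIf [Preorder α] (c : α → Prop) {f : α → α} (hf : Inflationary f) :
    Inflationary (applyIf c f) := fun a => by
  by_cases h : c a
  · rw [applyIf_pos f h]; exact hf a
  · rw [applyIf_neg f h]

theorem le_of_applyIf_le [Preorder α] {c : α → Prop} {f : α → α} {a : α}
    (h : applyIf c f a ≤ a) (hc : c a) : f a ≤ a := by
  rwa [applyIf_pos f hc] at h

theorem applyIf_induction {c : α → Prop} {f : α → α} {p : α → Prop} {a : α} (ha : p a)
    (hf : c a → p (f a)) : p (applyIf c f a) := by
  by_cases h : c a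
  · rw [applyIf_pos f h]; exact hf h
  · rwa [applyIf_neg f h]

end

namespace Forcing
variable {n : ℕ}

/-- Finite binary relations on `Fin n`. -/
abbrev Rel (n : ℕ) : Type := Finset (Fin n × Fin n)

/-- Add the pair `(i, j)`. -/
def put (i j : Fin n) : Rel n → Rel n := insert (i, j)

/-- If `(i, j)` is present, add `(k, l)`. -/
noncomputable def imply (i j k l : Fin n) : Rel n → Rel n :=
  applyIf (fun R => (i, j) ∈ R) (put k l)

/-- The transitivity rule. -/
noncomputable def transStep (u v w : Fin n) : Rel n → Rel n :=
  applyIf (fun R => (u, v) ∈ R) (imply v w u w)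

/-- The four rules for a vertex `v` not adjacent to `u` and a neighbour `w` of `u`. -/
noncomputable def moveStep (u v w : Fin n) : Rel n → Rel n := fun R =>
  imply v w v u (imply v u v w (imply w v u v (imply u v w v R)))

/-- Apply the rules for the triple `(u, v, w)`. -/
noncomputable def step (G : Fin n → Fin n → ℕ) (u v w : Fin n) : Rel n → Rel n := fun R =>
  -- The part `imply u u v w` is not needed for forcing; it makes a loop fill the whole relation, so
  -- that one entry reveals it.
  applyIf (fun _ => 0 < G u w) (applyIf (fun _ => ¬ 0 < G u v)
    (applyIf (fun _ => u ≠ v) (moveStep u v w))) (imply u u v w (transStep u v w R))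

/-- Apply the rules for all triples. -/
noncomputable def sweep (G : Fin n → Fin n → ℕ) : Rel n → Rel n :=
  forEach fun u => forEach fun v => forEach fun w => step G u v w

/-- Close under the rules. -/
noncomputable def close (G : Fin n → Fin n → ℕ) : Rel n → Rel n :=
  forEach fun _ : Fin n => forEach fun _ : Fin n => sweep G

/-- Orient the edge `ab` if it is undecided. -/
noncomputable def choose (G : Fin n → Fin n → ℕ) (a b : Fin n) : Rel n → Rel n :=
  applyIf (fun _ => b < a) (applyIf (fun _ => 0 < G a b) (applyIf (fun R => ¬ (a, b) ∈ R)
    (applyIf (fun R => ¬ (b, a) ∈ R) (put a b))))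

/-- Collect the arcs of the input. -/
noncomputable def start (G : Fin n → Fin n → ℕ) : Rel n → Rel n :=
  forEach fun u => forEach fun v => applyIf (fun _ => 2 < G v u) (put u v)

/-- Orient all undecided edges, closing under the rules each time. -/
noncomputable def orient (G : Fin n → Fin n → ℕ) : Rel n → Rel n :=
  forEach fun a => forEach fun b => fun R => close G (choose G a b R)

/-- The whole computation. -/
noncomputable def outcome (G : Fin n → Fin n → ℕ) : Rel n := orient G (close G (start G ∅))

/-! ### Fixed points of the sweep are closed relations. -/

theorem put_inflationary (i j : Fin n) : Inflationary (put i j) := fun _ =>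
  Finset.subset_insert _ _

theorem imply_inflationary (i j k l : Fin n) : Inflationary (imply i j k l) :=
  (put_inflationary _ _).applyIf _

theorem transStep_inflationary (u v w : Fin n) : Inflationary (transStep u v w) :=
  (imply_inflationary _ _ _ _).applyIf _

theorem moveStep_inflationary (u v w : Fin n) : Inflationary (moveStep u v w) :=
  (imply_inflationary _ _ _ _).comp ((imply_inflationary _ _ _ _).comp
    ((imply_inflationary _ _ _ _).comp (imply_inflationary _ _ _ _)))

variable (G : Fin n → Fin n → ℕ)

theorem step_inflationary (u v w : Fin n) : Inflationary (step G u v w) :=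
  ((((moveStep_inflationary u v w).applyIf _).applyIf _).applyIf _).comp
    ((imply_inflationary _ _ _ _).comp (transStep_inflationary _ _ _))

theorem sweep_inflationary : Inflationary (sweep G) :=
  Inflationary.forEach fun _ => Inflationary.forEach fun _ => Inflationary.forEach fun _ =>
    step_inflationary G _ _ _

theorem close_inflationary : Inflationary (close G) :=
  Inflationary.forEach fun _ => Inflationary.forEach fun _ => sweep_inflationary G

theorem choose_inflationary (a b : Fin n) : Inflationary (choose G a b) :=
  ((((put_inflationary a b).applyIf _).applyIf _).applyIf _).applyIf _

theorem orient_inflationary : Inflationary (orient G) :=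
  Inflationary.forEach fun _ => Inflationary.forEach fun _ =>
    (close_inflationary G).comp (choose_inflationary G _ _)

theorem sweep_close_le (R : Rel n) : sweep G (close G R) ≤ close G R := by
  have : close G = (sweep G)^[n * n] := by
    unfold close
    rw [forEach_const, forEach_const, Function.iterate_mul]
  rw [this]
  exact (sweep_inflationary G).iterate_stable R (by simp)

variable {G}

theorem mem_of_imply_le {i j k l : Fin n} {R : Rel n} (h : imply i j k l R ≤ R)
    (hij : (i, j) ∈ R) : (k, l) ∈ R :=
  le_of_applyIf_le h hij (Finset.mem_insert_self _ _)

variable {H : SimpleGraph (Fin n)}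

theorem step_le_of_sweep_le {R : Rel n} (h : sweep G R ≤ R) (u v w : Fin n) : step G u v w R ≤ R :=
  le_of_forEach_le (fun _ => step_inflationary G _ _ _)
    (le_of_forEach_le (fun _ => Inflationary.forEach fun _ => step_inflationary G _ _ _)
      (le_of_forEach_le (fun _ => Inflationary.forEach fun _ => Inflationary.forEach fun _ =>
        step_inflationary G _ _ _) h u) v) w

/-- All steps are inflationary, so a relation fixed by their composition is fixed by each of them,
and each rule can be read off separately. -/
theorem rules_of_sweep_le {R : Rel n} (h : sweep G R ≤ R) (u v w : Fin n) :
    ((u, v) ∈ R → (v, w) ∈ R → (u, w) ∈ R) ∧ ((u, u) ∈ R → (v, w) ∈ R) ∧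
    (0 < G u w → u ≠ v → ¬ 0 < G u v →
      ((u, v) ∈ R ↔ (w, v) ∈ R) ∧ ((v, u) ∈ R ↔ (v, w) ∈ R)) := by
  have hs := step_le_of_sweep_le h u v w
  obtain ⟨h1, h2⟩ := Inflationary.of_comp_le
    ((((moveStep_inflationary u v w).applyIf _).applyIf _).applyIf _)
    ((imply_inflationary _ _ _ _).comp (transStep_inflationary _ _ _)) hs
  obtain ⟨h3, h4⟩ := Inflationary.of_comp_le (imply_inflationary _ _ _ _)
    (transStep_inflationary _ _ _) h1
  refine ⟨fun huv hvw => mem_of_imply_le (le_of_applyIf_le h3 huv) hvw,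
    fun huu => mem_of_imply_le h4 huu, fun huw hne huv => ?_⟩
  have h5 : moveStep u v w R ≤ R :=
    le_of_applyIf_le (le_of_applyIf_le (le_of_applyIf_le h2 huw) huv) hne
  obtain ⟨h6, h7⟩ := Inflationary.of_comp_le (imply_inflationary _ _ _ _)
    ((imply_inflationary _ _ _ _).comp
    ((imply_inflationary _ _ _ _).comp (imply_inflationary _ _ _ _))) h5
  obtain ⟨h8, h9⟩ := Inflationary.of_comp_le (imply_inflationary _ _ _ _)
    ((imply_inflationary _ _ _ _).comp (imply_inflationary _ _ _ _)) h6
  obtain ⟨h10, h11⟩ := Inflationary.of_comp_le (imply_inflationary _ _ _ _)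
    (imply_inflationary _ _ _ _) h8
  exact ⟨⟨mem_of_imply_le h10, mem_of_imply_le h11⟩, mem_of_imply_le h9, mem_of_imply_le h7⟩

theorem isForcingClosed_of_sweep_le (hG : ∀ u v, H.Adj u v ↔ 0 < G u v) {R : Rel n}
    (h : sweep G R ≤ R) : IsForcingClosed H fun u v => (u, v) ∈ R where
  trans u v w := (rules_of_sweep_le h u v w).1
  left u v w huw hne huv := ((rules_of_sweep_le h u v w).2.2 ((hG _ _).1 huw) hne
    fun e => huv ((hG _ _).2 e)).1
  right u v w huw hne huv := ((rules_of_sweep_le h u v w).2.2 ((hG _ _).1 huw) hne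
    fun e => huv ((hG _ _).2 e)).2

/-! ### Correctness: the computed relation stays inside a straight order. -/

/-- The relation `R` is contained in the relation `lt`. -/
def Below (lt : Fin n → Fin n → Prop) (R : Rel n) : Prop := ∀ u v, (u, v) ∈ R → lt u v

variable {lt : Fin n → Fin n → Prop}

theorem Below.put {R : Rel n} (hR : Below lt R) {i j : Fin n} (h : lt i j) :
    Below lt (put i j R) := by
  intro u v huv
  rcases Finset.mem_insert.1 huv with e | e
  · cases e; exact h
  · exact hR u v e

theorem Below.imply {R : Rel n} (hR : Below lt R) {i j k l : Fin n} (h : lt i j → lt k l) :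
    Below lt (imply i j k l R) :=
  applyIf_induction (p := Below lt) hR fun e => hR.put (h (hR _ _ e))

theorem Below.step {R : Rel n} (hR : Below lt R) (hlt : IsStraightOrder H lt)
    (hG : ∀ u v, H.Adj u v ↔ 0 < G u v) (u v w : Fin n) : Below lt (step G u v w R) := by
  have h1 : Below lt (transStep u v w R) :=
    applyIf_induction (p := Below lt) hR fun e => hR.imply fun e' => hlt.trans _ _ _ (hR _ _ e) e'
  have h2 := h1.imply (i := u) (j := u) (k := v) (l := w) fun e => absurd e (hlt.irrefl u)
  refine applyIf_induction (p := Below lt) h2 fun huw => applyIf_induction (p := Below lt) h2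
    fun huv => applyIf_induction (p := Below lt) h2 fun hne => ?_
  have huw' := (hG _ _).2 huw
  have huv' := fun e => huv ((hG _ _).1 e)
  have hl := hlt.isForcingClosed.left u v w huw' hne huv'
  have hr := hlt.isForcingClosed.right u v w huw' hne huv'
  exact (((h2.imply hl.1).imply hl.2).imply hr.1).imply hr.2

theorem Below.close {R : Rel n} (hR : Below lt R) (hlt : IsStraightOrder H lt)
    (hG : ∀ u v, H.Adj u v ↔ 0 < G u v) : Below lt (close G R) :=
  forEach_induction (fun _ _ h1 => forEach_induction (fun _ _ h2 => forEach_induction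
    (fun _ _ h3 => forEach_induction (fun _ _ h4 => forEach_induction
      (fun _ _ h5 => h5.step hlt hG _ _ _) h4) h3) h2) h1) hR

theorem Below.start {R : Rel n} (hR : Below lt R) (hlt : ∀ u v, 2 < G v u → lt u v) :
    Below lt (start G R) :=
  forEach_induction (fun _ _ h1 => forEach_induction (fun _ _ h2 =>
    applyIf_induction (p := Below lt) h2 fun e => h2.put (hlt _ _ e)) h1) hR

/-- If the relation is closed and contained in a straight order, then so is the outcome. -/
theorem exists_below_orient (hG : ∀ u v, H.Adj u v ↔ 0 < G u v) {R : Rel n}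
    (hR : sweep G R ≤ R) (hlt : IsStraightOrder H lt) (hlt' : Below lt R) :
    ∃ lt', IsStraightOrder H lt' ∧ Below lt' (orient G R) := by
  refine (forEach_induction (p := fun R => sweep G R ≤ R ∧ ∃ lt', IsStraightOrder H lt' ∧
    Below lt' R) (fun a R h => forEach_induction (p := fun R => sweep G R ≤ R ∧ ∃ lt',
      IsStraightOrder H lt' ∧ Below lt' R) (fun b R h => ?_) h) ⟨hR, lt, hlt, hlt'⟩).2
  obtain ⟨hR, lt, hlt, hlt'⟩ := h
  refine ⟨sweep_close_le G _, ?_⟩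
  have key : ∃ lt', IsStraightOrder H lt' ∧ Below lt' (choose G a b R) := by
    have h0 : ∃ lt', IsStraightOrder H lt' ∧ Below lt' R := ⟨lt, hlt, hlt'⟩
    refine applyIf_induction (p := fun R => ∃ lt', IsStraightOrder H lt' ∧ Below lt' R) h0 fun _ =>
      applyIf_induction (p := fun R => ∃ lt', IsStraightOrder H lt' ∧ Below lt' R) h0 fun hab =>
      applyIf_induction (p := fun R => ∃ lt', IsStraightOrder H lt' ∧ Below lt' R) h0 fun _ =>
      applyIf_induction (p := fun R => ∃ lt', IsStraightOrder H lt' ∧ Below lt' R) h0 fun hba => ?_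
    -- The straight order may change with each chosen edge; only its existence is an invariant.
    obtain ⟨lt', h1, h2, h3⟩ := (isForcingClosed_of_sweep_le hG hR).exists_straightOrder hlt hlt'
      ((hG a b).2 hab) hba
    exact ⟨lt', h1, Below.put h2 h3⟩
  obtain ⟨lt', h1, h2⟩ := key
  exact ⟨lt', h1, h2.close h1 hG⟩

theorem sweep_orient_le {R : Rel n} (hR : sweep G R ≤ R) : sweep G (orient G R) ≤ orient G R :=
  forEach_induction (p := fun R => sweep G R ≤ R) (fun _ _ h => forEach_induction
    (p := fun R => sweep G R ≤ R) (fun _ _ _ => sweep_close_le G _) h) hR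

theorem mem_choose {a b : Fin n} (hba : b < a) (hG : 0 < G a b) (R : Rel n) :
    (a, b) ∈ choose G a b R ∨ (b, a) ∈ choose G a b R := by
  by_cases h1 : (a, b) ∈ R
  · exact Or.inl (choose_inflationary G a b R h1)
  by_cases h2 : (b, a) ∈ R
  · exact Or.inr (choose_inflationary G a b R h2)
  · left
    unfold choose
    rw [applyIf_pos (c := fun _ => b < a) _ hba, applyIf_pos (c := fun _ => 0 < G a b) _ hG,
      applyIf_pos (c := fun R => ¬ (a, b) ∈ R) _ h1,
      applyIf_pos (c := fun R => ¬ (b, a) ∈ R) _ h2]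
    exact Finset.mem_insert_self _ _

/-- The edge is decided at its own stage of the double loop, and pairs are never removed later. -/
theorem mem_orient {a b : Fin n} (hba : b < a) (hG : 0 < G a b) (R : Rel n) :
    (a, b) ∈ orient G R ∨ (b, a) ∈ orient G R := by
  have h0 : ∀ a b, Inflationary fun R => close G (choose G a b R) := fun a b =>
    (close_inflationary G).comp (choose_inflationary G a b)
  obtain ⟨R', -, h1⟩ := exists_stage_forEach (fun a => Inflationary.forEach (h0 a)) a R
  obtain ⟨R'', -, h2⟩ := exists_stage_forEach (h0 a) b R'
  have h3 := (close_inflationary G (choose G a b R'')).trans (h2.trans h1)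
  exact (mem_choose hba hG R'').imp (fun e => h3 e) (fun e => h3 e)

theorem mem_start {u v : Fin n} (hG : 2 < G v u) (R : Rel n) : (u, v) ∈ start G R := by
  have h0 : ∀ u v, Inflationary (applyIf (fun _ : Rel n => 2 < G v u) (put u v)) := fun u v =>
    (put_inflationary u v).applyIf _
  obtain ⟨R', -, h1⟩ := exists_stage_forEach (fun a => Inflationary.forEach (h0 a)) u R
  obtain ⟨R'', -, h2⟩ := exists_stage_forEach (h0 u) v R'
  refine h1 (h2 ?_)
  rw [applyIf_pos (c := fun _ => 2 < G v u) _ hG]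
  exact Finset.mem_insert_self _ _

theorem entry_pos_iff (P : PartiallyOrientedGraph (Fin n)) (u v : Fin n) :
    P.underlying.Adj u v ↔ 0 < P.entry u v := by
  change P.edges.Adj u v ∨ P.arcs.Adj u v ∨ P.arcs.Adj v u ↔ _
  unfold PartiallyOrientedGraph.entry
  split_ifs <;> simp_all

/-- An arc is recognised by the entry `3` at the transposed position, since exceeding `2` can be
tested by one truncated subtraction. -/
theorem two_lt_entry_iff (P : PartiallyOrientedGraph (Fin n)) (u v : Fin n) :
    2 < P.entry v u ↔ P.arcs.Adj u v := by
  have h1 := P.oriented u v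
  have h2 := P.disjoint u v
  have h3 := P.edges.adj_comm u v
  unfold PartiallyOrientedGraph.entry
  split_ifs <;> simp_all

/-- The outcome of the computation contains a loop, and then every pair, exactly if there is no
completion. -/
theorem mem_outcome_iff (P : PartiallyOrientedGraph (Fin n)) (i : Fin n) :
    (i, i) ∈ outcome P.entry ↔ ¬ ∃ D, IsCompletion P D ∧ IsAcyclicLocalTournament D := by
  have hclosed : sweep P.entry (outcome P.entry) ≤ outcome P.entry :=
    sweep_orient_le (sweep_close_le _ _)
  constructor
  · rintro hi ⟨D, hPD, hD⟩
    have hlt := hPD.isStraightOrder hD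
    have h0 : Below (Relation.TransGen D.Adj) (start P.entry ∅) :=
      Below.start (by intro u v h; simp at h)
        fun u v h => .single (hPD.arc_mem _ _ ((two_lt_entry_iff P u v).1 h))
    obtain ⟨lt', h1, h2⟩ := exists_below_orient (entry_pos_iff P) (sweep_close_le _ _) hlt
      (h0.close hlt (entry_pos_iff P))
    exact h1.irrefl i (h2 i i hi)
  · contrapose!
    intro hi
    refine (isForcingClosed_of_sweep_le (entry_pos_iff P) hclosed).exists_completion
      -- By the loop rule, a loop at any `x` would produce the excluded loop at `i`.
      (fun x hx => hi ((rules_of_sweep_le hclosed x i i).2.1 hx)) (fun x y hxy => ?_)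
      fun x y hxy => ?_
    · rcases lt_trichotomy x y with h | h | h
      · exact (mem_orient h ((entry_pos_iff P _ _).1 hxy.symm) _).symm
      · exact absurd h hxy.ne
      · exact mem_orient h ((entry_pos_iff P _ _).1 hxy) _
    · exact orient_inflationary _ _ (close_inflationary _ _
        (mem_start ((two_lt_entry_iff P x y).2 hxy) _))

end Forcing

/-! ## The program -/

namespace RAM
open Forcing

/-- The memory holds the matrix `G`, and after it the indicator matrix of the relation `R`. -/
structure Holds {n : ℕ} (G : Fin n → Fin n → ℕ) (R : Rel n) (m : ℕ → ℕ) : Prop where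
  graph : ∀ u v : Fin n, m (1 + u * n + v) = G u v
  rel : ∀ u v : Fin n, m (n * n + 1 + u * n + v) = if (u, v) ∈ R then 1 else 0
  -- The answer is read from cell `n * n + 1`. For `n = 0` this is cell `1`, about which `rel` says
  -- nothing.
  zero : n = 0 → m 1 = 0

/-- The registers below `k` have the values that `ρ` prescribes. -/
def Agree (k : ℕ) (ρ : ℕ → ℕ) (s : Config) : Prop := ∀ r < k, s.reg r = ρ r

/-- Started with the relation `R` in memory, and with registers below `k` as in `ρ`, the program
`p` puts the relation `f R` into memory, in at most `T` steps, and preserves these registers. -/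
def Does {n : ℕ} (G : Fin n → Fin n → ℕ) (ρ : ℕ → ℕ) (k : ℕ) (p : Prog) (T : ℕ)
    (f : Rel n → Rel n) : Prop :=
  ∀ s R, Holds G R s.mem → Agree k ρ s →
    ∃ t s', Runs p s t s' ∧ t ≤ T ∧ Holds G (f R) s'.mem ∧ Agree k ρ s'

/-- The program `p` makes register `k` nonzero if the condition `c` holds for the relation in
memory, and zero otherwise. It preserves the memory and the registers below `k`. -/
def Tests {n : ℕ} (G : Fin n → Fin n → ℕ) (ρ : ℕ → ℕ) (k : ℕ) (p : Prog) (T : ℕ)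
    (c : Rel n → Prop) : Prop :=
  ∀ s R, Holds G R s.mem → Agree k ρ s →
    ∃ t s', Runs p s t s' ∧ t ≤ T ∧ s'.mem = s.mem ∧ Agree k ρ s' ∧ (s'.reg k ≠ 0 ↔ c R)

/-- The registers `0, …, 5` hold the constants that the programs below use. -/
structure HasConsts (n : ℕ) (ρ : ℕ → ℕ) : Prop where
  r0 : ρ 0 = n * n + 1
  r1 : ρ 1 = 1
  r2 : ρ 2 = 2
  r3 : ρ 3 = n
  r4 : ρ 4 = n * n
  r5 : ρ 5 = 0

/-- The registers `a` and `a + 1` hold the vertex `i` and the offset of its row. -/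
structure HasVertex {n : ℕ} (ρ : ℕ → ℕ) (k a : ℕ) (i : Fin n) : Prop where
  lt : a + 1 < k
  idx : ρ a = i
  row : ρ (a + 1) = i * n

/-- The register contents `ρ` with the vertex `i` in the registers `k` and `k + 1`. -/
def withVertex {n : ℕ} (ρ : ℕ → ℕ) (k : ℕ) (i : Fin n) : ℕ → ℕ :=
  Function.update (Function.update ρ k i) (k + 1) (i * n)

/-- Run `p` if `c` leaves a nonzero number in register `k`. -/
def whenProg (k : ℕ) (c p : Prog) : Prog := .seq c (.ite k p .skip)

/-- Run `p` if `c` leaves zero in register `k`. -/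
def unlessProg (k : ℕ) (c p : Prog) : Prog := .seq c (.ite k .skip p)

/-- Run `p` for every vertex, held in the registers `k` and `k + 1`. -/
def forProg (k : ℕ) (p : Prog) : Prog :=
  -- Register `5` is zero, so the additions copy `n` and `n * n`. The row offset is updated along
  -- with the counter by subtracting `n`, which replaces a multiplication.
  .seq (.add k 3 5) (.seq (.add (k + 1) 4 5)
    (.loop k (.seq (.sub k k 1) (.seq (.sub (k + 1) (k + 1) 3) p))))

/-- Load the entry at the vertices in `a`, `b` of the matrix whose address is in register `r`. -/
def entryProg (k r a b : ℕ) : Prog := .seq (.add k r (a + 1)) (.seq (.add k k b) (.load k k))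

/-- Test whether two vertices are distinct. -/
def neProg (k a b : ℕ) : Prog := .seq (.sub k a b) (.seq (.sub (k + 1) b a) (.add k k (k + 1)))

/-- Add the pair of the vertices in `a`, `b` to the relation. -/
def putProg (k a b : ℕ) : Prog := .seq (.add k 0 (a + 1)) (.seq (.add k k b) (.store k 1))

variable {n : ℕ} {G : Fin n → Fin n → ℕ} {ρ : ℕ → ℕ} {k : ℕ}

/-! ### Correctness and time of the program constructs. -/

theorem HasConsts.withVertex (h : HasConsts n ρ) (hk : 6 ≤ k) (i : Fin n) :
    HasConsts n (withVertex ρ k i) := by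
  constructor <;> unfold RAM.withVertex <;>
    rw [Function.update_of_ne (by omega), Function.update_of_ne (by omega)]
  exacts [h.r0, h.r1, h.r2, h.r3, h.r4, h.r5]

theorem HasVertex.withVertex {a : ℕ} {j : Fin n} (h : HasVertex ρ k a j) (i : Fin n) :
    HasVertex (withVertex ρ k i) (k + 2) a j := by
  have := h.lt
  refine ⟨by omega, ?_, ?_⟩ <;> unfold RAM.withVertex <;>
    rw [Function.update_of_ne (by omega), Function.update_of_ne (by omega)]
  exacts [h.idx, h.row]

theorem hasVertex_withVertex (i : Fin n) : HasVertex (withVertex ρ k i) (k + 2) k i := by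
  refine ⟨by omega, ?_, ?_⟩ <;> unfold withVertex
  · rw [Function.update_of_ne (by omega), Function.update_self]
  · rw [Function.update_self]

theorem Agree.setReg {s : Config} (h : Agree k ρ s) {d : ℕ} (hd : k ≤ d) (x : ℕ) :
    Agree k ρ (s.setReg d x) := fun r hr => by
  rw [← h r hr]
  exact Function.update_of_ne (by omega) _ _

theorem setReg_reg_self (s : Config) (d x : ℕ) : (s.setReg d x).reg d = x :=
  Function.update_self _ _ _

theorem setReg_reg_of_ne (s : Config) {d r : ℕ} (h : r ≠ d) (x : ℕ) :
    (s.setReg d x).reg r = s.reg r := Function.update_of_ne h _ _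

theorem Does.seq {p q : Prog} {T T' : ℕ} {f g : Rel n → Rel n} (hp : Does G ρ k p T f)
    (hq : Does G ρ k q T' g) : Does G ρ k (.seq p q) (T + T') (fun R => g (f R)) := by
  intro s R hR hs
  obtain ⟨t, s', h1, h2, h3, h4⟩ := hp s R hR hs
  obtain ⟨t', s'', h1', h2', h3', h4'⟩ := hq s' _ h3 h4
  exact ⟨_, _, .seq h1 h1', by omega, h3', h4'⟩

theorem Tests.when {c p : Prog} {T T' : ℕ} {C : Rel n → Prop} {f : Rel n → Rel n}
    (hc : Tests G ρ k c T C) (hp : Does G ρ k p T' f) :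
    Does G ρ k (whenProg k c p) (T + T' + 2) (applyIf C f) := by
  intro s R hR hs
  obtain ⟨t, s', h1, h2, h3, h4, h5⟩ := hc s R hR hs
  by_cases h : C R
  · obtain ⟨t', s'', h1', h2', h3', h4'⟩ := hp s' R (h3 ▸ hR) h4
    refine ⟨_, _, .seq h1 (.ite_true (h5.2 h) h1'), by omega, ?_, h4'⟩
    rwa [applyIf_pos _ h]
  · refine ⟨_, _, .seq h1 (.ite_false (not_not.1 fun e => h (h5.1 e)) (.skip _)), by omega, ?_, h4⟩
    rwa [applyIf_neg _ h, h3]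

theorem Tests.unless {c p : Prog} {T T' : ℕ} {C : Rel n → Prop} {f : Rel n → Rel n}
    (hc : Tests G ρ k c T C) (hp : Does G ρ k p T' f) :
    Does G ρ k (unlessProg k c p) (T + T' + 2) (applyIf (fun R => ¬ C R) f) := by
  intro s R hR hs
  obtain ⟨t, s', h1, h2, h3, h4, h5⟩ := hc s R hR hs
  by_cases h : C R
  · refine ⟨_, _, .seq h1 (.ite_true (h5.2 h) (.skip _)), by omega, ?_, h4⟩
    rwa [applyIf_neg (c := fun R => ¬ C R) _ (not_not.2 h), h3]
  · obtain ⟨t', s'', h1', h2', h3', h4'⟩ := hp s' R (h3 ▸ hR) h4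
    refine ⟨_, _, .seq h1 (.ite_false (not_not.1 fun e => h (h5.1 e)) h1'), by omega, ?_, h4'⟩
    rwa [applyIf_pos (c := fun R => ¬ C R) _ h]

/-- The counter is decreased before the body runs, so the body sees `c - 1, …, 0`, the order of
`downFold`. Each round costs the test, two subtractions and the body, whence `T + 3`; the last test
gives the final `1`. -/
theorem runs_loop {p : Prog} {T : ℕ} {f : Fin n → Rel n → Rel n} (hk : 6 ≤ k)
    (hρ : HasConsts n ρ) (hp : ∀ i, Does G (withVertex ρ k i) (k + 2) p T (f i)) :
    ∀ (c : ℕ) (hc : c ≤ n) (s : Config) (R : Rel n), Holds G R s.mem → Agree k ρ s →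
      s.reg k = c → s.reg (k + 1) = c * n →
      ∃ t s', Runs (.loop k (.seq (.sub k k 1) (.seq (.sub (k + 1) (k + 1) 3) p))) s t s' ∧
        t ≤ c * (T + 3) + 1 ∧ Holds G (downFold f c hc R) s'.mem ∧ Agree k ρ s'
  | 0, _, s, R, hR, hs, h0, _ => ⟨1, s, .loop_done h0, by omega, hR, hs⟩
  | c + 1, hc, s, R, hR, hs, h0, h1 => by
    have e1 : s.reg 1 = 1 := (hs 1 (by omega)).trans hρ.r1
    have e3 : s.reg 3 = n := (hs 3 (by omega)).trans hρ.r3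
    let s1 := s.setReg k (s.reg k - s.reg 1)
    let s2 := s1.setReg (k + 1) (s1.reg (k + 1) - s1.reg 3)
    have g1 : s2.reg k = c := by
      simp only [s2, s1]
      rw [setReg_reg_of_ne _ (by omega), setReg_reg_self, e1, h0]
      omega
    have g2 : s2.reg (k + 1) = c * n := by
      simp only [s2, s1]
      rw [setReg_reg_self, setReg_reg_of_ne _ (by omega), setReg_reg_of_ne _ (by omega), e3, h1,
        Nat.succ_mul]
      omega
    have g3 : Agree k ρ s2 := (hs.setReg le_rfl _).setReg (by omega) _
    have g4 : Agree (k + 2) (withVertex ρ k ⟨c, hc⟩) s2 := by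
      intro r hr
      unfold withVertex
      rcases Nat.lt_trichotomy r k with h | h | h
      · rw [Function.update_of_ne (by omega), Function.update_of_ne (by omega), g3 r h]
      · rw [Function.update_of_ne (by omega), h, Function.update_self, g1]
      · obtain rfl : r = k + 1 := by omega
        rw [Function.update_self, g2]
    obtain ⟨t, s', r1, r2, r3, r4⟩ := hp ⟨c, hc⟩ s2 R hR g4
    have b1 : Agree k ρ s' := by
      intro r hr
      rw [r4 r (by omega)]
      unfold withVertex
      rw [Function.update_of_ne (by omega), Function.update_of_ne (by omega)]
    have b2 : s'.reg k = c := (r4 k (by omega)).trans (hasVertex_withVertex ⟨c, hc⟩).idx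
    have b3 : s'.reg (k + 1) = c * n := (r4 (k + 1) (by omega)).trans
      (hasVertex_withVertex ⟨c, hc⟩).row
    obtain ⟨t', s'', r1', r2', r3', r4'⟩ := runs_loop hk hρ hp c (Nat.le_of_succ_le hc) s' _ r3 b1
      b2 b3
    refine ⟨_, _, .loop_step (by omega) (.seq (.sub _ _ _ _) (.seq (.sub _ _ _ _) r1)) r1', ?_, r3',
      r4'⟩
    rw [Nat.succ_mul]
    omega

theorem Does.forEach {p : Prog} {T : ℕ} {f : Fin n → Rel n → Rel n} (hk : 6 ≤ k)
    (hρ : HasConsts n ρ) (hp : ∀ i, Does G (withVertex ρ k i) (k + 2) p T (f i)) :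
    Does G ρ k (forProg k p) (n * (T + 3) + 3) (forEach f) := by
  intro s R hR hs
  let s1 := s.setReg k (s.reg 3 + s.reg 5)
  let s2 := s1.setReg (k + 1) (s1.reg 4 + s1.reg 5)
  have e3 : s.reg 3 = n := (hs 3 (by omega)).trans hρ.r3
  have e4 : s.reg 4 = n * n := (hs 4 (by omega)).trans hρ.r4
  have e5 : s.reg 5 = 0 := (hs 5 (by omega)).trans hρ.r5
  have g1 : s2.reg k = n := by
    simp only [s2, s1]
    rw [setReg_reg_of_ne _ (by omega), setReg_reg_self, e3, e5, add_zero]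
  have g2 : s2.reg (k + 1) = n * n := by
    simp only [s2, s1]
    rw [setReg_reg_self, setReg_reg_of_ne _ (by omega), setReg_reg_of_ne _ (by omega), e4, e5,
      add_zero]
  have g3 : Agree k ρ s2 := (hs.setReg le_rfl _).setReg (by omega) _
  obtain ⟨t, s', h1, h2, h3, h4⟩ := runs_loop hk hρ hp n le_rfl s2 R hR g3 g1 g2
  exact ⟨_, _, .seq (.add _ _ _ _) (.seq (.add _ _ _ _) h1), by omega, h3, h4⟩

variable {a b : ℕ} {i j : Fin n}

theorem HasVertex.reg_idx (h : HasVertex ρ k a i) {s : Config} (hs : Agree k ρ s) :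
    s.reg a = i := (hs a (by have := h.lt; omega)).trans h.idx

theorem HasVertex.reg_row (h : HasVertex ρ k a i) {s : Config} (hs : Agree k ρ s) :
    s.reg (a + 1) = i * n := (hs (a + 1) h.lt).trans h.row

theorem runs_entry (ha : HasVertex ρ k a i) (hb : HasVertex ρ k b j) {r : ℕ} (hr : r < k)
    {s : Config} (hs : Agree k ρ s) :
    ∃ s', Runs (entryProg k r a b) s 3 s' ∧ s'.mem = s.mem ∧ Agree k ρ s' ∧
      s'.reg k = s.mem (ρ r + i * n + j) := by
  refine ⟨_, .seq (.add _ _ _ _) (.seq (.add _ _ _ _) (.load _ _ _)), rfl,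
    ((hs.setReg le_rfl _).setReg le_rfl _).setReg le_rfl _, ?_⟩
  have := hb.lt
  rw [setReg_reg_self, setReg_reg_self, setReg_reg_self, setReg_reg_of_ne _ (by omega), hs r hr,
    ha.reg_row hs, hb.reg_idx hs]
  rfl

theorem tests_mem (hk : 6 ≤ k) (hρ : HasConsts n ρ) (ha : HasVertex ρ k a i)
    (hb : HasVertex ρ k b j) : Tests G ρ k (entryProg k 0 a b) 3 fun R => (i, j) ∈ R := by
  intro s R hR hs
  obtain ⟨s', h1, h2, h3, h4⟩ := runs_entry ha hb (r := 0) (by omega) hs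
  refine ⟨3, s', h1, le_rfl, h2, h3, ?_⟩
  rw [h4, hρ.r0, hR.rel]
  simp

theorem tests_adj (hk : 6 ≤ k) (hρ : HasConsts n ρ) (ha : HasVertex ρ k a i)
    (hb : HasVertex ρ k b j) : Tests G ρ k (entryProg k 1 a b) 3 fun _ => 0 < G i j := by
  intro s R hR hs
  obtain ⟨s', h1, h2, h3, h4⟩ := runs_entry ha hb (r := 1) (by omega) hs
  refine ⟨3, s', h1, le_rfl, h2, h3, ?_⟩
  rw [h4, hρ.r1, hR.graph, Nat.pos_iff_ne_zero]

theorem tests_two_lt (hk : 6 ≤ k) (hρ : HasConsts n ρ) (ha : HasVertex ρ k a i)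
    (hb : HasVertex ρ k b j) :
    Tests G ρ k (.seq (entryProg k 1 a b) (.sub k k 2)) 4 fun _ => 2 < G i j := by
  intro s R hR hs
  obtain ⟨s', h1, h2, h3, h4⟩ := runs_entry ha hb (r := 1) (by omega) hs
  refine ⟨_, _, .seq h1 (.sub _ _ _ _), le_rfl, h2, h3.setReg le_rfl _, ?_⟩
  rw [setReg_reg_self, h4, hρ.r1, hR.graph, h3 2 (by omega), hρ.r2]
  omega

theorem tests_lt (ha : HasVertex ρ k a i) (hb : HasVertex ρ k b j) :
    Tests G ρ k (.sub k a b) 1 fun _ => j < i := by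
  intro s R _ hs
  refine ⟨_, _, .sub _ _ _ _, le_rfl, rfl, hs.setReg le_rfl _, ?_⟩
  rw [setReg_reg_self, ha.reg_idx hs, hb.reg_idx hs, Fin.lt_def]
  omega

theorem tests_ne (ha : HasVertex ρ k a i) (hb : HasVertex ρ k b j) :
    Tests G ρ k (neProg k a b) 3 fun _ => i ≠ j := by
  intro s R _ hs
  refine ⟨_, _, .seq (.sub _ _ _ _) (.seq (.sub _ _ _ _) (.add _ _ _ _)), le_rfl, rfl,
    ((hs.setReg le_rfl _).setReg (by omega) _).setReg le_rfl _, ?_⟩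
  have := hb.lt
  have := ha.lt
  rw [setReg_reg_self, setReg_reg_self, setReg_reg_of_ne _ (by omega), setReg_reg_self,
    setReg_reg_of_ne _ (by omega), setReg_reg_of_ne _ (by omega), ha.reg_idx hs, hb.reg_idx hs,
    Ne, Ne, Fin.ext_iff]
  omega

theorem rowMajor_lt (i j : Fin n) : (i : ℕ) * n + j < n * n := by
  have h1 : ((i : ℕ) + 1) * n ≤ n * n := Nat.mul_le_mul_right n i.2
  have := j.2
  rw [Nat.succ_mul] at h1
  omega

theorem rowMajor_injective {i j u v : Fin n} (h : (i : ℕ) * n + j = u * n + v) :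
    i = u ∧ j = v := by
  have e1 : ((i : ℕ) * n + j) / n = i := by
    rw [mul_comm, Nat.mul_add_div (by have := j.2; omega), Nat.div_eq_of_lt j.2, add_zero]
  have e2 : ((u : ℕ) * n + v) / n = u := by
    rw [mul_comm, Nat.mul_add_div (by have := j.2; omega), Nat.div_eq_of_lt v.2, add_zero]
  have e3 : (i : ℕ) = u := by rw [← e1, ← e2, h]
  refine ⟨Fin.ext e3, Fin.ext ?_⟩
  rw [e3] at h
  omega

theorem does_put (hk : 6 ≤ k) (hρ : HasConsts n ρ) (ha : HasVertex ρ k a i)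
    (hb : HasVertex ρ k b j) : Does G ρ k (putProg k a b) 3 (put i j) := by
  intro s R hR hs
  refine ⟨_, _, .seq (.add _ _ _ _) (.seq (.add _ _ _ _) (.store _ _ _)), le_rfl, ?_,
    (hs.setReg le_rfl _).setReg le_rfl _⟩
  have := hb.lt
  have e : ((s.setReg k (s.reg 0 + s.reg (a + 1))).setReg k
      ((s.setReg k (s.reg 0 + s.reg (a + 1))).reg k +
        (s.setReg k (s.reg 0 + s.reg (a + 1))).reg b)).reg k = n * n + 1 + i * n + j := by
    rw [setReg_reg_self, setReg_reg_self, setReg_reg_of_ne _ (by omega), hs 0 (by omega), hρ.r0,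
      ha.reg_row hs, hb.reg_idx hs]
  have e' : ((s.setReg k (s.reg 0 + s.reg (a + 1))).setReg k
      ((s.setReg k (s.reg 0 + s.reg (a + 1))).reg k +
        (s.setReg k (s.reg 0 + s.reg (a + 1))).reg b)).reg 1 = 1 := by
    rw [setReg_reg_of_ne _ (by omega), setReg_reg_of_ne _ (by omega), hs 1 (by omega), hρ.r1]
  rw [e, e']
  change Holds G (put i j R) (Function.update s.mem _ 1)
  refine ⟨fun u v => ?_, fun u v => ?_, fun h => absurd i.2 (by omega)⟩
  -- The graph occupies the cells up to `n * n`, below the relation matrix, and is not touched.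
  · have := rowMajor_lt u v
    rw [Function.update_of_ne (by omega), hR.graph]
  · by_cases huv : (u, v) = (i, j)
    · cases huv
      rw [Function.update_self]
      exact (if_pos (Finset.mem_insert_self (i, j) R)).symm
    · rw [Function.update_of_ne, hR.rel]
      · have : (u, v) ∈ put i j R ↔ (u, v) ∈ R := by
          unfold put
          rw [Finset.mem_insert]
          tauto
        simp only [this]
      · intro e
        obtain ⟨rfl, rfl⟩ := rowMajor_injective (i := u) (j := v) (u := i) (v := j) (by omega)
        exact huv rfl

/-! ### The forcing algorithm as a program. -/

/-- The program for `Forcing.imply`. -/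
def implyProg (k a b c d : ℕ) : Prog := whenProg k (entryProg k 0 a b) (putProg k c d)

/-- The program for `Forcing.transStep`. -/
def transProg (k u v w : ℕ) : Prog := whenProg k (entryProg k 0 u v) (implyProg k v w u w)

/-- The program for `Forcing.moveStep`. -/
def moveProg (k u v w : ℕ) : Prog :=
  .seq (.seq (.seq (implyProg k u v w v) (implyProg k w v u v)) (implyProg k v u v w))
    (implyProg k v w v u)

/-- The program for `Forcing.step`. -/
def stepProg (k u v w : ℕ) : Prog :=
  .seq (.seq (transProg k u v w) (implyProg k u u v w))
    (whenProg k (entryProg k 1 u w) (unlessProg k (entryProg k 1 u v)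
      (whenProg k (neProg k u v) (moveProg k u v w))))

/-- The program for `Forcing.close`. -/
def closeProg (k : ℕ) : Prog :=
  forProg k (forProg (k + 2) (forProg (k + 4) (forProg (k + 6) (forProg (k + 8)
    (stepProg (k + 10) (k + 4) (k + 6) (k + 8))))))

/-- The program for `Forcing.choose`. -/
def chooseProg (k a b : ℕ) : Prog :=
  whenProg k (.sub k a b) (whenProg k (entryProg k 1 a b) (unlessProg k (entryProg k 0 a b)
    (unlessProg k (entryProg k 0 b a) (putProg k a b))))

/-- The program for `Forcing.start`. -/
def startProg (k : ℕ) : Prog :=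
  forProg k (forProg (k + 2) (whenProg (k + 4)
    (.seq (entryProg (k + 4) 1 (k + 2) k) (.sub (k + 4) (k + 4) 2)) (putProg (k + 4) k (k + 2))))

/-- The program for `Forcing.orient`. -/
def orientProg (k : ℕ) : Prog :=
  forProg k (forProg (k + 2) (.seq (chooseProg (k + 4) k (k + 2)) (closeProg (k + 4))))

/-- The time for a loop over all `n` vertices. -/
def loopTime (n T : ℕ) : ℕ := n * (T + 3) + 3

/-- The time for `closeProg`. -/
def closeTime (n : ℕ) : ℕ :=
  -- The bound `68` for `stepProg` is `13 + 8 + 47`: transitivity, the loop rule, and four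
  -- implications of cost `8` under three tests of total cost `15`.
  loopTime n (loopTime n (loopTime n (loopTime n (loopTime n 68))))

theorem does_imply (hk : 6 ≤ k) (hρ : HasConsts n ρ) {c d : ℕ} {l m : Fin n}
    (ha : HasVertex ρ k a i) (hb : HasVertex ρ k b j) (hc : HasVertex ρ k c l)
    (hd : HasVertex ρ k d m) : Does G ρ k (implyProg k a b c d) 8 (imply i j l m) :=
  (tests_mem hk hρ ha hb).when (does_put hk hρ hc hd)

theorem does_step (hk : 6 ≤ k) (hρ : HasConsts n ρ) {c : ℕ} {l : Fin n}
    (ha : HasVertex ρ k a i) (hb : HasVertex ρ k b j) (hc : HasVertex ρ k c l) :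
    Does G ρ k (stepProg k a b c) 68 (step G i j l) :=
  (((tests_mem hk hρ ha hb).when (does_imply hk hρ hb hc ha hc)).seq
    (does_imply hk hρ ha ha hb hc)).seq
  ((tests_adj hk hρ ha hc).when ((tests_adj hk hρ ha hb).unless ((tests_ne ha hb).when
    ((((does_imply hk hρ ha hb hc hb).seq (does_imply hk hρ hc hb ha hb)).seq
      (does_imply hk hρ hb ha hb hc)).seq (does_imply hk hρ hb hc hb ha)))))

theorem does_close (hk : 6 ≤ k) (hρ : HasConsts n ρ) :
    Does G ρ k (closeProg k) (closeTime n) (close G) := by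
  refine Does.forEach hk hρ fun x => ?_
  have hρ := hρ.withVertex hk x
  refine Does.forEach (by omega) hρ fun y => ?_
  have hρ := hρ.withVertex (k := k + 2) (by omega) y
  refine Does.forEach (by omega) hρ fun u => ?_
  have hρ := hρ.withVertex (k := k + 4) (by omega) u
  refine Does.forEach (by omega) hρ fun v => ?_
  have hρ := hρ.withVertex (k := k + 6) (by omega) v
  refine Does.forEach (by omega) hρ fun w => ?_
  have hρ := hρ.withVertex (k := k + 8) (by omega) w
  exact does_step (by omega) hρ (((hasVertex_withVertex u).withVertex v).withVertex w)
    ((hasVertex_withVertex v).withVertex w) (hasVertex_withVertex w)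

theorem does_choose (hk : 6 ≤ k) (hρ : HasConsts n ρ) (ha : HasVertex ρ k a i)
    (hb : HasVertex ρ k b j) : Does G ρ k (chooseProg k a b) 21 (choose G i j) :=
  (tests_lt ha hb).when ((tests_adj hk hρ ha hb).when ((tests_mem hk hρ ha hb).unless
    ((tests_mem hk hρ hb ha).unless (does_put hk hρ ha hb))))

theorem does_start (hk : 6 ≤ k) (hρ : HasConsts n ρ) :
    Does G ρ k (startProg k) (loopTime n (loopTime n 9)) (start G) := by
  refine Does.forEach hk hρ fun u => ?_
  have hρ := hρ.withVertex hk u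
  refine Does.forEach (by omega) hρ fun v => ?_
  have hρ := hρ.withVertex (k := k + 2) (by omega) v
  have hu := (hasVertex_withVertex (ρ := ρ) (k := k) u).withVertex v
  have hv := hasVertex_withVertex (ρ := withVertex ρ k u) (k := k + 2) v
  exact (tests_two_lt (by omega) hρ hv hu).when (does_put (by omega) hρ hu hv)

theorem does_orient (hk : 6 ≤ k) (hρ : HasConsts n ρ) :
    Does G ρ k (orientProg k) (loopTime n (loopTime n (21 + closeTime n))) (orient G) := by
  refine Does.forEach hk hρ fun u => ?_
  have hρ := hρ.withVertex hk u
  refine Does.forEach (by omega) hρ fun v => ?_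
  have hρ := hρ.withVertex (k := k + 2) (by omega) v
  exact (does_choose (by omega) hρ ((hasVertex_withVertex u).withVertex v)
    (hasVertex_withVertex v)).seq (does_close (by omega) hρ)

/-- Put the constants into the registers. -/
def constsProg : Prog := .seq (.load 3 5) (.seq (.const 1 1) (.seq (.const 2 2) (.sub 4 0 1)))

/-- The program which decides the orientation completion problem for acyclic local tournaments. -/
def completionProg : Prog :=
  .seq constsProg (.seq (.seq (.seq (startProg 6) (closeProg 6)) (orientProg 6))
    (.seq (.load 0 0) (.sub 0 1 0)))

/-! ### The input, the running time and the final answer. -/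

theorem holds_encodePog (n : ℕ) (P : PartiallyOrientedGraph (Fin n)) :
    Holds P.entry ∅ (inputConfig (encodePog ⟨n, P⟩)).mem := by
  have hmem : ∀ x, (inputConfig (encodePog ⟨n, P⟩)).mem (x + 1) =
      (List.ofFn fun k : Fin (n * n) => P.entry k.divNat k.modNat).getD x 0 := fun x => rfl
  refine ⟨fun u v => ?_, fun u v => ?_, ?_⟩
  · have hlt := rowMajor_lt u v
    rw [show 1 + (u : ℕ) * n + v = (u * n + v) + 1 by omega, hmem, List.getD_eq_getElem?_getD,
      List.getElem?_ofFn, dif_pos hlt, Option.getD_some]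
    have hd : Fin.divNat (⟨u * n + v, hlt⟩ : Fin (n * n)) = u := by
      apply Fin.ext
      change ((u : ℕ) * n + v) / n = u
      rw [mul_comm, Nat.mul_add_div (by have := v.2; omega), Nat.div_eq_of_lt v.2, add_zero]
    have hm : Fin.modNat (⟨u * n + v, hlt⟩ : Fin (n * n)) = v := by
      apply Fin.ext
      change ((u : ℕ) * n + v) % n = v
      rw [mul_comm, Nat.mul_add_mod, Nat.mod_eq_of_lt v.2]
    rw [hd, hm]
  -- The cells beyond the input are zero, so the empty relation is already in memory.
  · rw [show n * n + 1 + (u : ℕ) * n + v = (n * n + (u * n + v)) + 1 by omega, hmem,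
      List.getD_eq_default _ _ (by simp)]
    simp
  · rintro rfl
    exact (hmem 0).trans (List.getD_eq_default _ _ (by simp))

theorem le_inputSize (n : ℕ) (P : PartiallyOrientedGraph (Fin n)) :
    n ≤ inputSize (encodePog ⟨n, P⟩) := by
  have h : ∀ l : List ℕ, l.length ≤ inputSize l := by
    intro l
    induction l with
    | nil => simp
    | cons a l ih => simp only [inputSize, List.map_cons, List.sum_cons, List.length_cons] at *; omega
  refine le_trans ?_ (h _)
  simp only [encodePog, List.length_cons, List.length_ofFn]
  nlinarith [Nat.le_mul_self n]

/-- The time for `completionProg`. -/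
def completionTime (n : ℕ) : ℕ :=
  4 + (loopTime n (loopTime n 9) + closeTime n + loopTime n (loopTime n (21 + closeTime n)) + 2)

theorem runs_completionProg (n : ℕ) (P : PartiallyOrientedGraph (Fin n)) :
    ∃ t s, Runs completionProg (inputConfig (encodePog ⟨n, P⟩)) t s ∧ t ≤ completionTime n ∧
      ∃ m, Holds P.entry (outcome P.entry) m ∧ s.reg 0 = 1 - m (n * n + 1) := by
  set s0 := inputConfig (encodePog ⟨n, P⟩) with hs0
  -- The length of the input happens to be the address of the relation matrix, and one less gives `n
  -- * n`. Register `5` is initially zero, so `load 3 5` reads `n` from cell `0`.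
  have h0 : s0.reg 0 = n * n + 1 := by simp [hs0, inputConfig, encodePog]
  have h5 : s0.reg 5 = 0 := by simp [hs0, inputConfig]
  have hm0 : s0.mem 0 = n := by simp [hs0, inputConfig, encodePog]
  obtain ⟨s1, hr1, hmem1, hc⟩ : ∃ s1, Runs constsProg s0 4 s1 ∧ s1.mem = s0.mem ∧
      HasConsts n s1.reg := by
    refine ⟨_, .seq (.load _ _ _) (.seq (.const _ _ _) (.seq (.const _ _ _) (.sub _ _ _ _))), rfl,
      ?_⟩
    constructor <;> simp [Config.setReg, Function.update, h0, h5, hm0]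
  have hH : Holds P.entry ∅ s1.mem := hmem1 ▸ holds_encodePog n P
  obtain ⟨t, s2, hr2, ht, hH2, hA⟩ := (((does_start le_rfl hc).seq (does_close le_rfl hc)).seq
    (does_orient le_rfl hc)) s1 ∅ hH fun _ _ => rfl
  refine ⟨_, _, .seq hr1 (.seq hr2 (.seq (.load _ _ _) (.sub _ _ _ _))), ?_, s2.mem, hH2, ?_⟩
  · unfold completionTime
    omega
  · rw [setReg_reg_self, setReg_reg_self, setReg_reg_of_ne _ (by omega), hA 1 (by omega), hc.r1,
      hA 0 (by omega), hc.r0]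

end RAM

theorem corollary4p5 :
    RAM.SolvableInPolyTime encodePog
      (OrientationCompletionProblem fun _ D => IsAcyclicLocalTournament D) := by
  -- `L` and `C` are `loopTime` and `closeTime` as polynomials in the input size, which bounds `n`.
  let L : Polynomial ℕ → Polynomial ℕ := fun T => Polynomial.X * (T + 3) + 3
  let C : Polynomial ℕ := L (L (L (L (L 68))))
  refine ⟨RAM.completionProg, 4 + (L (L 9) + C + L (L (21 + C)) + 2), fun ⟨n, P⟩ => ?_⟩
  obtain ⟨t, s, hr, ht, m, hm, h0⟩ := RAM.runs_completionProg n P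
  refine ⟨t, s, hr, ht.trans ?_, ?_⟩
  · have hn := RAM.le_inputSize n P
    simp only [L, C, Polynomial.eval_add, Polynomial.eval_mul, Polynomial.eval_X,
      Polynomial.eval_ofNat, RAM.completionTime, RAM.closeTime, RAM.loopTime]
    gcongr
  · rcases n.eq_zero_or_pos with rfl | hn
    -- Without vertices the answer cell is zero, so the program says yes, and the empty digraph is a
    -- completion.
    · rw [show 0 * 0 + 1 = 1 from rfl, hm.zero rfl] at h0
      exact ⟨fun _ => h0, fun h => absurd ⟨⟨fun _ _ => False⟩,
        ⟨fun u => u.elim0, fun u => u.elim0, fun u => u.elim0, fun u => u.elim0⟩,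
        ⟨fun u => u.elim0, fun u => u.elim0⟩, fun u => u.elim0⟩ h⟩
    · have hmem := hm.rel ⟨0, hn⟩ ⟨0, hn⟩
      rw [Nat.zero_mul, add_zero, add_zero] at hmem
      rw [hmem] at h0
      have key := Forcing.mem_outcome_iff P ⟨0, hn⟩
      constructor
      · intro hQ
        rw [h0, if_neg (fun e => key.1 e hQ)]
      · intro hQ
        rw [h0, if_pos (key.2 hQ)]
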